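/- **Setting.** For complex sequences $u,v\in\mathbb C^{\mathbb Z}$ let $[u*v]_t=\sum_\tau u_\tau v_{t-\tau}$, $[\Delta u]_t=u_{t-1}$, $\|u\|_{n,2}=\big(\sum_{t=0}^n|u_t|^2\big)^{1/2}$ and $$\|u\|^*_{m,1}=\sum_{k=0}^m\Big|\frac1{\sqrt{m+1}}\sum_{t=0}^m u_t e^{2\pi i kt/(m+1)}\Big| .$$ Let $m,n\ge 1$ be integers. One observes $y_t=x_t+\sigma\zeta_t$, where $\sigma\ge 0$ and the $\zeta_t$ are i.i.d. standard complex Gaussian ($\zeta_t=\xi^1_t+i\xi^2_t$ with $\xi^1_t,\xi_t^2$ independent $\mathcal N(0,1)$). Assume that $x=x^{\mathcal S}+\varepsilon$ with $x^{\mathcal S}\in\mathcal S$, where $\mathcal S\subset\mathbb C^{\mathbb Z}$ is an (unknown) linear subspace with $\Delta\mathcal S\subseteq\mathcal S$ of dimension $s$, $1\le s\le n+1$, and that, for some $\varkappa\ge0$, $\|\Delta^\tau\varepsilon\|_{n,2}\le\varkappa\sigma$ for all $0\le\tau\le m$. For $\lambda>0$ the penalized least-squares filter $\widehat\varphi$ is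 any minimizer, over the filters $\varphi$ supported on $\{0,\dots,m\}$, of $$\|y-\varphi*y\|_{n,2}^2+\lambda^2\sigma^2\big(\sqrt{m+1}\,\|\varphi\|^*_{m,1}\big)^2 .$$ For $\alpha\in(0,1]$ put $\kappa=\sqrt{(n+1)/(m+1)}$, $c_\alpha=\sqrt{2\ln(16/\alpha)}$, $V_\alpha=2(1+4\kappa)^2\ln\big(55(m+n+1)/\alpha\big)$, $W_\alpha=(1+\kappa)^2(1+c_\alpha)^2$, $\ell_\alpha=\max\{\ln(1/\alpha),\ln 2\}$ and $$r_1=\max\{1,\kappa^2\}\ln\frac{m+n}{\alpha}+\varkappa\sqrt{\ell_\alpha}+1,\qquad r_2=\varrho\ln\frac1\alpha+\varkappa\sqrt{\ell_\alpha}+s .$$ **Theorem.** There are absolute constants $C,C',C''>0$ such that the following holds in this setting for every $\varrho\ge1$, every (deterministic) filter $\varphi$ supported on $\{0,\dots,m\}$ with $\|\varphi\|^*_{m,1}\le\varrho/\sqrt{m+1}$, and every $\alpha\in(0,1]$. There is a set $\Xi_\alpha$ of realizations of the noise with $\mathbb P\{\zeta\in\Xi_\alpha\}\ge1-\alpha$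 such that, whenever $\zeta\in\Xi_\alpha$, every penalized least-squares filter $\widehat\varphi$ satisfies 1. $$\|x-\widehat\varphi*y\|_{n,2}\le\|x-\varphi*y\|_{n,2}+\sigma\big(\lambda\varrho+4\lambda^{-1}(c_\alpha\varkappa+V_\alpha)\big)+2\sigma\Big[\sqrt{\varrho W_\alpha}+\sqrt{c_\alpha\varkappa}+\sqrt{2s}+c_\alpha\Big];$$ 2. $$\|x-\widehat\varphi*y\|_{n,2}\le\|x-\varphi*y\|_{n,2}+\sigma\big[\lambda\varrho+C\lambda^{-1}r_1+C'r_2^{1/2}\big];$$ 3. in particular, if $\lambda=r_1^{1/2}$, then $$\|x-\widehat\varphi*y\|_{n,2}\le\|x-\varphi*y\|_{n,2}+\sigma\big[C''\varrho\, r_1^{1/2}+C'r_2^{1/2}\big].$$ -/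

import Mathlib

open MeasureTheory ProbabilityTheory

namespace SignalRecovery

noncomputable section

/-- The right shift on two-sided complex sequences: `[Δ x]_t = x_{t-1}`. -/
def shift (x : ℤ → ℂ) : ℤ → ℂ := fun t => x (t - 1)

/-- The space of sequences supported on `{0, …, m}` (the filters of bandwidth `m`). -/
def filters (m : ℕ) : Submodule ℂ (ℤ → ℂ) where
  carrier := {φ | ∀ t : ℤ, t ∉ Set.Icc (0 : ℤ) (m : ℤ) → φ t = 0}
  add_mem' := fun {a b} ha hb t ht => by simp [ha t ht, hb t ht]
  zero_mem' := fun t _ => rfl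
  smul_mem' := fun c a ha t ht => by simp [ha t ht]

/-- The convolution `[u * v]_t = ∑_τ u_τ v_{t-τ}`. -/
def conv (u v : ℤ → ℂ) : ℤ → ℂ := fun t => ∑' τ : ℤ, u τ * v (t - τ)

/-- The Euclidean norm `‖x‖_{n,2}` of the window `(x_0, …, x_n)`. -/
def windowNorm (n : ℕ) (x : ℤ → ℂ) : ℝ :=
  √(∑ t ∈ Finset.range (n + 1), ‖x (t : ℤ)‖ ^ 2)

/-- The `k`-th coordinate of the unitary discrete Fourier transform of `(x_0, …, x_n)`. -/
def dft (n : ℕ) (x : ℤ → ℂ) (k : ℕ) : ℂ :=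
  ((√((n : ℝ) + 1))⁻¹ : ℝ) *
    ∑ t ∈ Finset.range (n + 1),
      x (t : ℤ) * Complex.exp (2 * Real.pi * Complex.I * k * t / (n + 1))

/-- The norm `‖x‖*_{n,1}`: the `ℓ₁`-norm of the discrete Fourier transform of `(x_0, …, x_n)`. -/
def fourierL1 (n : ℕ) (x : ℤ → ℂ) : ℝ :=
  ∑ k ∈ Finset.range (n + 1), ‖dft n x k‖

/-- The objective of the penalized least-squares problem,
`‖y - φ * y‖²_{n,2} + λ² σ² (√(m+1) ‖φ‖*_{m,1})²`. -/
def penalizedObjective (m n : ℕ) (lam σ : ℝ) (y φ : ℤ → ℂ) : ℝ :=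
  windowNorm n (y - conv φ y) ^ 2
    + lam ^ 2 * σ ^ 2 * (√((m : ℝ) + 1) * fourierL1 m φ) ^ 2

/-- `φ` is an optimal solution of the penalized least-squares problem over all filters of
bandwidth `m`, for the data `y`. -/
def IsPenalizedSolution (m n : ℕ) (lam σ : ℝ) (y φ : ℤ → ℂ) : Prop :=
  φ ∈ filters m ∧ ∀ ψ ∈ filters m,
    penalizedObjective m n lam σ y φ ≤ penalizedObjective m n lam σ y ψ

/-- The signal `x` decomposes as `x = xS + ε`, with `xS` in a shift-invariant subspace of
dimension `s`, `1 ≤ s ≤ n + 1`, and `‖Δ^τ ε‖_{n,2} ≤ ϰ σ` for `0 ≤ τ ≤ m`. -/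
def NearShiftInvariant (m n s : ℕ) (ϰ σ : ℝ) (x : ℤ → ℂ) : Prop :=
  1 ≤ s ∧ s ≤ n + 1 ∧
    ∃ S : Submodule ℂ (ℤ → ℂ), (∀ u ∈ S, shift u ∈ S) ∧ Module.finrank ℂ S = s ∧
      ∃ xS ∈ S, ∃ ε : ℤ → ℂ, x = xS + ε ∧
        ∀ τ : ℕ, τ ≤ m → windowNorm n (shift^[τ] ε) ≤ ϰ * σ

/-- The standard complex Gaussian law: the law of `ξ¹ + i ξ²` with `ξ¹, ξ²` independent and
standard normal. -/
def stdComplexGaussian : Measure ℂ :=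
  ((gaussianReal 0 1).prod (gaussianReal 0 1)).map (fun p : ℝ × ℝ => (p.1 : ℂ) + p.2 * Complex.I)

/-- `κ_{m,n} = √((n+1)/(m+1))`. -/
def kappa (m n : ℕ) : ℝ := √(((n : ℝ) + 1) / ((m : ℝ) + 1))

/-- `c_α = √(2 ln(16/α))`. -/
def cAlpha (α : ℝ) : ℝ := √(2 * Real.log (16 / α))

/-- `V_α = 2 (1 + 4 κ_{m,n})² ln(55 (m+n+1)/α)`. -/
def vAlpha (m n : ℕ) (α : ℝ) : ℝ :=
  2 * (1 + 4 * kappa m n) ^ 2 * Real.log (55 * ((m : ℝ) + n + 1) / α)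

/-- `W_α = (1 + κ_{m,n})² (1 + c_α)²`. -/
def wAlpha (m n : ℕ) (α : ℝ) : ℝ := (1 + kappa m n) ^ 2 * (1 + cAlpha α) ^ 2

/-- `r₁ = max(1, κ²_{m,n}) ln((m+n)/α) + ϰ √(max(ln(1/α), ln 2)) + 1`. For `m ≤ n` and
`α ≤ 1/2` this is `κ²_{m,n} ln((m+n)/α) + ϰ √(ln(1/α)) + 1`. -/
def r1 (m n : ℕ) (ϰ α : ℝ) : ℝ :=
  max 1 (kappa m n ^ 2) * Real.log (((m : ℝ) + n) / α)
    + ϰ * √(max (Real.log (1 / α)) (Real.log 2)) + 1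

/-- `r₂ = ϱ ln(1/α) + ϰ √(max(ln(1/α), ln 2)) + s`. For `α ≤ 1/2` this is
`ϱ ln(1/α) + ϰ √(ln(1/α)) + s`. -/
def r2 (ϱ : ℝ) (s : ℕ) (ϰ α : ℝ) : ℝ :=
  ϱ * Real.log (1 / α) + ϰ * √(max (Real.log (1 / α)) (Real.log 2)) + s

end

end SignalRecovery

/-!
Comparing the penalized solution `φ̂` with `φ` gives, for the residuals `a = x - φ * y` and
`X = x - φ̂ * y` on the window,
`‖X‖² ≤ ‖a‖² + 2σ Re⟪a - X, ζ⟫ + λ²σ²(r² - r̂²)`, where `r`, `r̂` are the penalized norms.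
Split `ζ` along the restriction of `𝒮` to the window and its orthogonal complement. The first
part has dimension at most `s`, so its norm is at most `√(2s) + c_α` with large probability. The
second part does not see `φ * x^𝒮`, because `𝒮` is shift-invariant; what remains is linear in the
discrete Fourier transform of the filter, hence at most `r + r̂` times a bound `4(c_α ϰ + V_α)` on
single frequencies, and the penalty absorbs it by completing the square in `r̂`.

On one frequency, Cauchy–Schwarz bounds the `ε`-contribution through the `m + 1` Gaussian linear
forms `⟪Δ^τ ε, ζ⟫`. The noise contribution is the quadratic form of a Toeplitz matrix: embedded
into a circular convolution of length `m + n + 1` it is diagonal in the Fourier basis, with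
Dirichlet-kernel values as eigenvalues. These are at most `√(m+1)` in modulus and have
logarithmic normalized `ℓ¹`-norm, so the Chernoff bound for weighted `χ²` variables and a union
bound over the `m + 1` frequencies cost only `V_α`.
-/

namespace SignalRecovery

open scoped RealInnerProductSpace FourierTransform

/-! ### Quadratic forms in a standard Gaussian vector -/

theorem integrable_exp_mul_sq_gaussianReal {u : ℝ} (hu : u < 1 / 2) :
    Integrable (fun x : ℝ => Real.exp (u * x ^ 2)) (gaussianReal 0 1) := by
  rw [gaussianReal_of_var_ne_zero 0 one_ne_zero, gaussianPDF_def,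
    integrable_withDensity_iff_integrable_smul₀' (by fun_prop) (by simp)]
  have h := (integrable_exp_neg_mul_sq (b := 1 / 2 - u) (by linarith)).const_mul
    (√(2 * Real.pi))⁻¹
  refine h.congr (Filter.Eventually.of_forall fun x => ?_)
  simp only [gaussianPDFReal, smul_eq_mul, sub_zero, NNReal.coe_one, mul_one]
  rw [ENNReal.toReal_ofReal (by positivity), mul_assoc, ← Real.exp_add]
  congr 2; ring

theorem integral_exp_mul_sq_gaussianReal {u : ℝ} (hu : u < 1 / 2) :
    ∫ x : ℝ, Real.exp (u * x ^ 2) ∂(gaussianReal 0 1) = (1 - 2 * u) ^ (-(1 / 2) : ℝ) := by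
  have hdensity : ∀ x : ℝ, gaussianPDFReal 0 1 x • Real.exp (u * x ^ 2)
      = (√(2 * Real.pi))⁻¹ * Real.exp (-(1 / 2 - u) * x ^ 2) := by
    intro x
    simp only [gaussianPDFReal, smul_eq_mul, sub_zero, NNReal.coe_one, mul_one]
    rw [mul_assoc, ← Real.exp_add]
    congr 2; ring
  rw [integral_gaussianReal_eq_integral_smul one_ne_zero]
  simp_rw [hdensity]
  rw [integral_const_mul, integral_gaussian, Real.rpow_neg (by linarith), ← Real.sqrt_eq_rpow,
    ← Real.sqrt_inv, ← Real.sqrt_inv, ← Real.sqrt_mul (by positivity)]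
  have h₁ : 1 - 2 * u ≠ 0 := by linarith
  have : 1 / 2 - u ≠ 0 := by linarith
  congr 1
  field_simp

section QuadraticForm

variable {E : Type*} [NormedAddCommGroup E] [InnerProductSpace ℝ E] [FiniteDimensional ℝ E]
  {T : E →ₗ[ℝ] E}

theorem inner_map_self_eq_sum_eigenvalues_mul_sq (hT : T.IsSymmetric) (x : E) :
    ⟪x, T x⟫ = ∑ i, hT.eigenvalues rfl i * ⟪hT.eigenvectorBasis rfl i, x⟫ ^ 2 := by
  rw [← (hT.eigenvectorBasis rfl).sum_inner_mul_inner]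
  refine Finset.sum_congr rfl fun i _ => ?_
  rw [← hT, hT.apply_eigenvectorBasis, real_inner_comm, RCLike.ofReal_real_eq_id, id_eq,
    real_inner_smul_left]
  ring

theorem eigenvalues_le_one (hT : T.IsSymmetric) (hle : ∀ x, ⟪x, T x⟫ ≤ ‖x‖ ^ 2)
    (i : Fin (Module.finrank ℝ E)) : hT.eigenvalues rfl i ≤ 1 := by
  have h := hle (hT.eigenvectorBasis rfl i)
  rw [hT.apply_eigenvectorBasis, RCLike.ofReal_real_eq_id, id_eq, real_inner_smul_right,
    real_inner_self_eq_norm_sq, (hT.eigenvectorBasis rfl).norm_eq_one] at h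
  simpa only [one_pow, mul_one] using h

theorem exp_mul_inner_map_self_sum_smul (hT : T.IsSymmetric) (θ : ℝ)
    (g : Fin (Module.finrank ℝ E) → ℝ) :
    Real.exp (θ * ⟪∑ i, g i • hT.eigenvectorBasis rfl i,
        T (∑ i, g i • hT.eigenvectorBasis rfl i)⟫)
      = ∏ i, Real.exp (θ * hT.eigenvalues rfl i * g i ^ 2) := by
  rw [inner_map_self_eq_sum_eigenvalues_mul_sq hT, ← Real.exp_sum, Finset.mul_sum]
  congr 1
  refine Finset.sum_congr rfl fun i _ => ?_
  rw [(hT.eigenvectorBasis rfl).orthonormal.inner_right_fintype, mul_assoc]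

variable [MeasurableSpace E] [BorelSpace E]

theorem integrable_exp_mul_inner_map_self_stdGaussian (hT : T.IsSymmetric) {θ : ℝ}
    (hθ : ∀ i, θ * hT.eigenvalues rfl i < 1 / 2) :
    Integrable (fun x => Real.exp (θ * ⟪x, T x⟫)) (stdGaussian E) := by
  have hc : Continuous fun x => Real.exp (θ * ⟪x, T x⟫) := by
    have := T.continuous_of_finiteDimensional
    fun_prop
  rw [stdGaussian_eq_map_pi_orthonormalBasis (hT.eigenvectorBasis rfl),
    integrable_map_measure hc.aestronglyMeasurable
      (Measurable.aemeasurable (by fun_prop))]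
  simp_rw [Function.comp_def, exp_mul_inner_map_self_sum_smul hT θ]
  exact Integrable.fintype_prod fun i => integrable_exp_mul_sq_gaussianReal (hθ i)

theorem mgf_inner_map_self_stdGaussian (hT : T.IsSymmetric) {θ : ℝ}
    (hθ : ∀ i, θ * hT.eigenvalues rfl i < 1 / 2) :
    mgf (fun x => ⟪x, T x⟫) (stdGaussian E) θ
      = ∏ i, (1 - 2 * (θ * hT.eigenvalues rfl i)) ^ (-(1 / 2) : ℝ) := by
  have hc : Continuous fun x => Real.exp (θ * ⟪x, T x⟫) := by
    have := T.continuous_of_finiteDimensional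
    fun_prop
  rw [mgf, stdGaussian_eq_map_pi_orthonormalBasis (hT.eigenvectorBasis rfl),
    integral_map (Measurable.aemeasurable (by fun_prop)) hc.aestronglyMeasurable]
  simp_rw [exp_mul_inner_map_self_sum_smul hT θ]
  rw [integral_fintype_prod_eq_prod
    (f := fun i x => Real.exp (θ * hT.eigenvalues rfl i * x ^ 2))]
  exact Finset.prod_congr rfl fun i _ => integral_exp_mul_sq_gaussianReal (hθ i)

theorem one_sub_mul_rpow_neg_half_le {θ w : ℝ} (hθ' : θ < 1 / 2) (hw₀ : 0 ≤ w)
    (hw₁ : w ≤ 1) :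
    (1 - 2 * (θ * w)) ^ (-(1 / 2) : ℝ) ≤ (1 - 2 * θ) ^ (-(w / 2)) := by
  have hbernoulli := rpow_one_add_le_one_add_mul_self (s := -(2 * θ)) (by linarith) hw₀ hw₁
  calc (1 - 2 * (θ * w)) ^ (-(1 / 2) : ℝ) = (1 + w * -(2 * θ)) ^ (-(1 / 2) : ℝ) := by
        congr 1; ring
    _ ≤ ((1 + -(2 * θ)) ^ w) ^ (-(1 / 2) : ℝ) :=
        Real.rpow_le_rpow_of_nonpos (Real.rpow_pos_of_pos (by linarith) w) hbernoulli
          (by norm_num)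
    _ = (1 - 2 * θ) ^ (-(w / 2)) := by
        rw [← Real.rpow_mul (by linarith), ← sub_eq_add_neg]
        congr 1; ring

theorem stdGaussian_inner_map_self_tail (hT : T.IsPositive) (hle : ∀ x, ⟪x, T x⟫ ≤ ‖x‖ ^ 2)
    {θ : ℝ} (hθ : 0 ≤ θ) (hθ' : θ < 1 / 2) (t : ℝ) :
    (stdGaussian E).real {x | t ≤ ⟪x, T x⟫}
      ≤ Real.exp (-θ * t) * (1 - 2 * θ) ^ (-(LinearMap.trace ℝ E T / 2)) := by
  have hw₀ := hT.nonneg_eigenvalues rfl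
  have hw₁ := eigenvalues_le_one hT.isSymmetric hle
  have hθw : ∀ i, θ * hT.isSymmetric.eigenvalues rfl i < 1 / 2 := fun i =>
    (mul_le_of_le_one_right hθ (hw₁ i)).trans_lt hθ'
  refine (measure_ge_le_exp_mul_mgf t hθ
    (integrable_exp_mul_inner_map_self_stdGaussian hT.isSymmetric hθw)).trans ?_
  rw [mgf_inner_map_self_stdGaussian hT.isSymmetric hθw,
    hT.isSymmetric.trace_eq_sum_eigenvalues rfl, RCLike.ofReal_real_eq_id, id_eq,
    Finset.sum_div, ← Finset.sum_neg_distrib, Real.rpow_sum_of_pos (by linarith)]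
  gcongr with i
  · exact fun i _ => Real.rpow_nonneg (by linarith [hθw i]) _
  · exact one_sub_mul_rpow_neg_half_le hθ' (hw₀ i) (hw₁ i)

theorem stdGaussian_sum_sq_tail {J : Type*} [Fintype J] (f : J → E)
    (hf : ∀ x, ∑ j, ⟪f j, x⟫ ^ 2 ≤ ‖x‖ ^ 2) {θ : ℝ} (hθ : 0 ≤ θ) (hθ' : θ < 1 / 2) (t : ℝ) :
    (stdGaussian E).real {x | t ≤ ∑ j, ⟪f j, x⟫ ^ 2}
      ≤ Real.exp (-θ * t) * (1 - 2 * θ) ^ (-((∑ j, ‖f j‖ ^ 2) / 2)) := by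
  let T : E →ₗ[ℝ] E := ∑ j, InnerProductSpace.rankOne ℝ (f j) (f j)
  have hform : ∀ x, ⟪x, T x⟫ = ∑ j, ⟪f j, x⟫ ^ 2 := fun x => by
    simp only [T, LinearMap.sum_apply, ContinuousLinearMap.coe_coe,
      InnerProductSpace.rankOne_apply, inner_sum, real_inner_smul_right]
    exact Finset.sum_congr rfl fun j _ => by rw [real_inner_comm, sq]
  have htrace : LinearMap.trace ℝ E T = ∑ j, ‖f j‖ ^ 2 := by
    simp only [T, map_sum, InnerProductSpace.trace_rankOne, real_inner_self_eq_norm_sq]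
  have hpos : T.IsPositive := LinearMap.isPositive_sum _ fun j _ =>
    (InnerProductSpace.isPositive_rankOne_self (f j)).toLinearMap
  simpa only [hform, htrace] using
    stdGaussian_inner_map_self_tail hpos (fun x => (hform x).trans_le (hf x)) hθ hθ' t

end QuadraticForm

/-! ### Complex Gaussian vectors -/

theorem charFun_stdComplexGaussian (t : ℂ) :
    charFun stdComplexGaussian t = Complex.exp (-‖t‖ ^ 2 / 2) := by
  have hexp : ∀ p : ℝ × ℝ, Complex.exp ((⟪(p.1 : ℂ) + p.2 * Complex.I, t⟫ : ℝ) * Complex.I)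
      = Complex.exp (t.re * p.1 * Complex.I) * Complex.exp (t.im * p.2 * Complex.I) := by
    intro p
    have hinner : ⟪(p.1 : ℂ) + p.2 * Complex.I, t⟫ = t.re * p.1 + t.im * p.2 := by
      simp [Complex.inner]
    rw [← Complex.exp_add, hinner]
    push_cast
    ring_nf
  rw [charFun_apply, stdComplexGaussian, integral_map (by fun_prop) (by fun_prop)]
  simp_rw [hexp]
  rw [integral_prod_mul (fun x : ℝ => Complex.exp (t.re * x * Complex.I))
    (fun x : ℝ => Complex.exp (t.im * x * Complex.I)),
    ← charFun_apply_real, ← charFun_apply_real, charFun_gaussianReal, charFun_gaussianReal,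
    ← Complex.exp_add, ← Complex.ofReal_pow ‖t‖, ← Complex.normSq_eq_norm_sq,
    Complex.normSq_apply]
  congr 1
  push_cast
  simp only [mul_zero, zero_mul, zero_sub, one_mul]
  ring

instance : IsProbabilityMeasure stdComplexGaussian :=
  Measure.isProbabilityMeasure_map (by fun_prop)

section ComplexGaussian

variable {ι : Type*} [Fintype ι]

theorem hasLaw_stdGaussian_of_iIndepFun {Ω : Type*} [MeasurableSpace Ω] {P : Measure Ω}
    {ζ : ι → Ω → ℂ} (hζ : ∀ i, HasLaw (ζ i) stdComplexGaussian P) (hind : iIndepFun ζ P) :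
    HasLaw (fun ω => WithLp.toLp 2 fun i => ζ i ω) (stdGaussian (EuclideanSpace ℂ ι)) P := by
  have hlaw : HasLaw (WithLp.toLp 2 : (ι → ℂ) → EuclideanSpace ℂ ι)
      (stdGaussian (EuclideanSpace ℂ ι)) (Measure.pi fun _ => stdComplexGaussian) := by
    refine ⟨by fun_prop, ?_⟩
    have : IsFiniteMeasure ((Measure.pi fun _ : ι => stdComplexGaussian).map (WithLp.toLp 2)) :=
      Measure.isFiniteMeasure_map _ _
    refine Measure.ext_of_charFun ?_
    ext t
    rw [charFun_pi, charFun_stdGaussian]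
    simp_rw [charFun_stdComplexGaussian]
    rw [← Complex.exp_sum, ← Finset.sum_div, Finset.sum_neg_distrib, ← Complex.ofReal_pow,
      PiLp.norm_sq_eq_of_L2]
    push_cast
    rfl
  exact hlaw.fun_comp (hind.hasLaw_pi hζ)

theorem norm_inner_sq_eq_add (f x : EuclideanSpace ℂ ι) :
    ‖inner ℂ f x‖ ^ 2 = ⟪f, x⟫ ^ 2 + ⟪Complex.I • f, x⟫ ^ 2 := by
  have hre : ∀ g : EuclideanSpace ℂ ι, ⟪g, x⟫ = (inner ℂ g x).re := fun g => by
    simp [PiLp.inner_apply, Complex.inner]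
  rw [hre, hre, inner_smul_left, ← Complex.normSq_eq_norm_sq, Complex.normSq_apply]
  simp only [Complex.conj_I, neg_mul, Complex.neg_re, Complex.I_mul_re, neg_neg]
  ring

theorem stdGaussian_sum_norm_inner_sq_tail {J : Type*} [Fintype J] (f : J → EuclideanSpace ℂ ι)
    (hf : ∀ x, ∑ j, ‖inner ℂ (f j) x‖ ^ 2 ≤ ‖x‖ ^ 2)
    {θ : ℝ} (hθ : 0 ≤ θ) (hθ' : θ < 1 / 2) (t : ℝ) :
    (stdGaussian (EuclideanSpace ℂ ι)).real {x | t ≤ ∑ j, ‖inner ℂ (f j) x‖ ^ 2}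
      ≤ Real.exp (-θ * t) * (1 - 2 * θ) ^ (-∑ j, ‖f j‖ ^ 2) := by
  have hsum : ∀ x, ∑ j : J ⊕ J, ⟪Sum.elim f (fun j => Complex.I • f j) j, x⟫ ^ 2
      = ∑ j, ‖inner ℂ (f j) x‖ ^ 2 := fun x => by
    simp only [norm_inner_sq_eq_add, Fintype.sum_sum_type, Sum.elim_inl, Sum.elim_inr,
      Finset.sum_add_distrib]
  have hnorm : (∑ j : J ⊕ J, ‖Sum.elim f (fun j => Complex.I • f j) j‖ ^ 2) / 2
      = ∑ j, ‖f j‖ ^ 2 := by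
    simp only [Fintype.sum_sum_type, Sum.elim_inl, Sum.elim_inr, norm_smul, Complex.norm_I,
      one_mul, add_self_div_two]
  simpa only [hsum, hnorm] using stdGaussian_sum_sq_tail
    (Sum.elim f fun j => Complex.I • f j) (fun x => (hsum x).trans_le (hf x)) hθ hθ' t

theorem stdGaussian_sum_norm_inner_sq_scaled_tail {J : Type*} [Fintype J]
    (f : J → EuclideanSpace ℂ ι) {L Λ : ℝ} (hL : 0 ≤ L)
    (hf : ∀ x, ∑ j, ‖inner ℂ (f j) x‖ ^ 2 ≤ L * ‖x‖ ^ 2)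
    (hfΛ : ∑ j, ‖f j‖ ^ 2 ≤ L * Λ) (t : ℝ) :
    (stdGaussian (EuclideanSpace ℂ ι)).real {x | L * t < ∑ j, ‖inner ℂ (f j) x‖ ^ 2}
      ≤ 2 ^ Λ * Real.exp (-(t / 4)) := by
  rcases hL.eq_or_lt with rfl | hL
  · have hempty : {x | 0 * t < ∑ j, ‖inner ℂ (f j) x‖ ^ 2} = ∅ :=
      Set.eq_empty_of_forall_notMem fun x hx => by
        have hx' : 0 * t < ∑ j, ‖inner ℂ (f j) x‖ ^ 2 := hx
        linarith [hf x]
    rw [hempty, measureReal_empty]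
    positivity
  set g := fun j => ((√L)⁻¹ : ℂ) • f j with hg
  have hgx : ∀ x, ∑ j, ‖inner ℂ (g j) x‖ ^ 2 = L⁻¹ * ∑ j, ‖inner ℂ (f j) x‖ ^ 2 := fun x => by
    simp only [hg, inner_smul_left, norm_mul, mul_pow, RCLike.norm_conj, norm_inv,
      Complex.norm_real, inv_pow, Real.norm_eq_abs, sq_abs, Real.sq_sqrt hL.le, Finset.mul_sum]
  have hgΛ : ∑ j, ‖g j‖ ^ 2 ≤ Λ := by
    simp only [hg, norm_smul, mul_pow, norm_inv, Complex.norm_real, inv_pow, Real.norm_eq_abs,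
      sq_abs, Real.sq_sqrt hL.le, ← Finset.mul_sum]
    rwa [inv_mul_le_iff₀ hL]
  have hgle : ∀ x, ∑ j, ‖inner ℂ (g j) x‖ ^ 2 ≤ ‖x‖ ^ 2 := fun x => by
    rw [hgx, inv_mul_le_iff₀ hL]
    exact hf x
  calc (stdGaussian (EuclideanSpace ℂ ι)).real {x | L * t < ∑ j, ‖inner ℂ (f j) x‖ ^ 2}
      ≤ (stdGaussian (EuclideanSpace ℂ ι)).real {x | t ≤ ∑ j, ‖inner ℂ (g j) x‖ ^ 2} :=
        measureReal_mono fun x hx => by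
          rw [Set.mem_ofPred_eq] at hx ⊢
          rw [hgx, le_inv_mul_iff₀ hL]
          exact hx.le
    _ ≤ Real.exp (-(1 / 4) * t) * (1 - 2 * (1 / 4)) ^ (-∑ j, ‖g j‖ ^ 2) :=
        stdGaussian_sum_norm_inner_sq_tail g hgle (by norm_num) (by norm_num) t
    _ = 2 ^ (∑ j, ‖g j‖ ^ 2) * Real.exp (-(t / 4)) := by
        rw [show (1 - 2 * (1 / 4) : ℝ) = 2⁻¹ by norm_num, Real.rpow_neg (by positivity),
          Real.inv_rpow (by norm_num), inv_inv, mul_comm]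
        ring_nf
    _ ≤ 2 ^ Λ * Real.exp (-(t / 4)) := by
        gcongr
        norm_num

theorem exp_mul_one_sub_rpow_le {q c : ℝ} (hq : 0 < q) (hc : 0 ≤ c) :
    Real.exp (-(c / (2 * (q + c))) * (q + c) ^ 2)
        * (1 - 2 * (c / (2 * (q + c)))) ^ (-(q ^ 2 / 2)) ≤ Real.exp (-(c ^ 2 / 2)) := by
  have hbase : 1 - 2 * (c / (2 * (q + c))) = (1 + c / q)⁻¹ := by field_simp; ring
  have hpow : (1 + c / q) ^ (q ^ 2 / 2) ≤ Real.exp (q * c / 2) := by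
    calc (1 + c / q) ^ (q ^ 2 / 2) ≤ Real.exp (c / q) ^ (q ^ 2 / 2) := by
          gcongr
          linarith [Real.add_one_le_exp (c / q)]
      _ = Real.exp (q * c / 2) := by
          rw [← Real.exp_mul]
          congr 1
          field_simp
  rw [hbase, Real.rpow_neg (by positivity), Real.inv_rpow (by positivity), inv_inv]
  calc _ ≤ Real.exp (-(c / (2 * (q + c))) * (q + c) ^ 2) * Real.exp (q * c / 2) := by gcongr
    _ = Real.exp (-(c ^ 2 / 2)) := by
        rw [← Real.exp_add]
        congr 1
        field_simp
        ring

section Contraction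

variable {F : Type*} [NormedAddCommGroup F] [InnerProductSpace ℂ F]

theorem norm_starProjection_sq (K : Submodule ℂ F) [FiniteDimensional ℂ K] (v : F) :
    ‖K.starProjection v‖ ^ 2 = ∑ i, ‖inner ℂ (stdOrthonormalBasis ℂ K i : F) v‖ ^ 2 := by
  rw [Submodule.starProjection_apply, Submodule.norm_coe,
    ← (stdOrthonormalBasis ℂ K).sum_sq_norm_inner_right]
  simp_rw [Submodule.inner_orthogonalProjectionOnto_eq_of_mem_left]

variable [CompleteSpace F] {A : EuclideanSpace ℂ ι →L[ℂ] F}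

theorem norm_adjoint_apply_le (hA : ‖A‖ ≤ 1) (y : F) :
    ‖ContinuousLinearMap.adjoint A y‖ ≤ ‖y‖ :=
  (ContinuousLinearMap.adjoint A).le_of_opNorm_le
    (by rwa [LinearIsometryEquiv.norm_map]) y |>.trans_eq (one_mul _)

theorem stdGaussian_norm_starProjection_tail (hA : ‖A‖ ≤ 1) (K : Submodule ℂ F)
    [FiniteDimensional ℂ K] {s : ℕ} (hs : 1 ≤ s) (hK : Module.finrank ℂ K ≤ s)
    {c : ℝ} (hc : 0 ≤ c) :
    (stdGaussian (EuclideanSpace ℂ ι)).real {x | √(2 * s) + c < ‖K.starProjection (A x)‖}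
      ≤ Real.exp (-(c ^ 2 / 2)) := by
  set q := √(2 * (s : ℝ)) with hq
  have hq₀ : 0 < q := Real.sqrt_pos.2 (by positivity)
  have hqs : q ^ 2 / 2 = s := by rw [hq, Real.sq_sqrt (by positivity)]; ring
  set θ := c / (2 * (q + c)) with hθ
  have hθ₀ : 0 ≤ θ := by positivity
  have hθ₁ : θ < 1 / 2 := by
    rw [hθ, div_lt_div_iff₀ (by positivity) (by norm_num)]; linarith
  let f := fun i => ContinuousLinearMap.adjoint A (stdOrthonormalBasis ℂ K i : F)
  have hfx : ∀ x, ∑ i, ‖inner ℂ (f i) x‖ ^ 2 = ‖K.starProjection (A x)‖ ^ 2 := fun x => by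
    simp only [f, ContinuousLinearMap.adjoint_inner_left, norm_starProjection_sq]
  have hf : ∀ x, ∑ i, ‖inner ℂ (f i) x‖ ^ 2 ≤ ‖x‖ ^ 2 := fun x => by
    rw [hfx]
    gcongr
    exact (K.norm_starProjection_apply_le _).trans
      ((A.le_of_opNorm_le hA x).trans_eq (one_mul _))
  have hfs : ∑ i, ‖f i‖ ^ 2 ≤ q ^ 2 / 2 := by
    calc ∑ i, ‖f i‖ ^ 2 ≤ ∑ _i : Fin (Module.finrank ℂ K), (1 : ℝ) := by
          refine Finset.sum_le_sum fun i _ => ?_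
          refine pow_le_one₀ (norm_nonneg _) ((norm_adjoint_apply_le hA _).trans ?_)
          rw [Submodule.norm_coe, (stdOrthonormalBasis ℂ K).norm_eq_one]
      _ ≤ q ^ 2 / 2 := by simpa [hqs] using hK
  calc (stdGaussian (EuclideanSpace ℂ ι)).real {x | q + c < ‖K.starProjection (A x)‖}
      ≤ (stdGaussian (EuclideanSpace ℂ ι)).real {x | (q + c) ^ 2 ≤ ∑ j, ‖inner ℂ (f j) x‖ ^ 2} :=
        measureReal_mono fun x hx => by
          rw [Set.mem_ofPred_eq] at hx ⊢
          rw [hfx]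
          gcongr
    _ ≤ Real.exp (-θ * (q + c) ^ 2) * (1 - 2 * θ) ^ (-∑ j, ‖f j‖ ^ 2) :=
        stdGaussian_sum_norm_inner_sq_tail f hf hθ₀ hθ₁ _
    _ ≤ Real.exp (-θ * (q + c) ^ 2) * (1 - 2 * θ) ^ (-(q ^ 2 / 2)) := by
        gcongr ?_ * ?_
        exact Real.rpow_le_rpow_of_exponent_ge (by linarith) (by linarith) (by linarith)
    _ ≤ Real.exp (-(c ^ 2 / 2)) := exp_mul_one_sub_rpow_le hq₀ hc

theorem stdGaussian_sum_inner_sq_tail {J : Type*} [Fintype J] (hA : ‖A‖ ≤ 1) (g : J → F)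
    {W : ℝ} (hg : ∑ j, ‖g j‖ ^ 2 ≤ W) (t : ℝ) :
    (stdGaussian (EuclideanSpace ℂ ι)).real {x | W * t < ∑ j, ‖inner ℂ (g j) (A x)‖ ^ 2}
      ≤ 2 * Real.exp (-(t / 4)) := by
  have hW : 0 ≤ W := hg.trans' (by positivity)
  have h := stdGaussian_sum_norm_inner_sq_scaled_tail
    (fun j => ContinuousLinearMap.adjoint A (g j)) (Λ := 1) hW (fun x => ?_) ?_ t
  · simpa only [ContinuousLinearMap.adjoint_inner_left, Real.rpow_one] using h
  · calc ∑ j, ‖inner ℂ (ContinuousLinearMap.adjoint A (g j)) x‖ ^ 2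
        ≤ ∑ j, ‖g j‖ ^ 2 * ‖x‖ ^ 2 := Finset.sum_le_sum fun j _ => by
          rw [← mul_pow]
          gcongr
          exact (norm_inner_le_norm _ _).trans (by gcongr; exact norm_adjoint_apply_le hA _)
      _ ≤ W * ‖x‖ ^ 2 := by
          rw [← Finset.sum_mul]
          gcongr
  · rw [mul_one]
    refine (Finset.sum_le_sum fun j _ => ?_).trans hg
    gcongr
    exact norm_adjoint_apply_le hA _

theorem stdGaussian_weighted_sum_tail {J : Type*} [Fintype J] (hA : ‖A‖ ≤ 1) {e : J → F}
    (he : Orthonormal ℂ e) {c : J → ℝ} {L Λ : ℝ} (hL : 0 ≤ L) (hc : ∀ j, 0 ≤ c j)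
    (hcL : ∀ j, c j ≤ L) (hsum : ∑ j, c j ≤ L * Λ) (t : ℝ) :
    (stdGaussian (EuclideanSpace ℂ ι)).real {x | L * t < ∑ j, c j * ‖inner ℂ (e j) (A x)‖ ^ 2}
      ≤ 2 ^ Λ * Real.exp (-(t / 4)) := by
  let f := fun j => (√(c j) : ℂ) • ContinuousLinearMap.adjoint A (e j)
  have hfx : ∀ x, ∑ j, ‖inner ℂ (f j) x‖ ^ 2 = ∑ j, c j * ‖inner ℂ (e j) (A x)‖ ^ 2 :=
    fun x => by
      refine Finset.sum_congr rfl fun j _ => ?_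
      simp only [f, inner_smul_left, ContinuousLinearMap.adjoint_inner_left, norm_mul, mul_pow,
        RCLike.norm_conj, Complex.norm_real, Real.norm_eq_abs, sq_abs, Real.sq_sqrt (hc j)]
  have h := stdGaussian_sum_norm_inner_sq_scaled_tail f (Λ := Λ) hL (fun x => ?_) ?_ t
  · simpa only [hfx] using h
  · calc ∑ j, ‖inner ℂ (f j) x‖ ^ 2 = ∑ j, c j * ‖inner ℂ (e j) (A x)‖ ^ 2 := hfx x
      _ ≤ ∑ j, L * ‖inner ℂ (e j) (A x)‖ ^ 2 := by gcongr; exact hcL _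
      _ ≤ L * ‖x‖ ^ 2 := by
          rw [← Finset.mul_sum]
          gcongr
          refine (he.sum_inner_products_le _).trans ?_
          gcongr
          exact (A.le_of_opNorm_le hA x).trans_eq (one_mul _)
  · refine (Finset.sum_le_sum fun j _ => ?_).trans hsum
    rw [norm_smul, Complex.norm_real, mul_pow, Real.norm_eq_abs, sq_abs, Real.sq_sqrt (hc j)]
    refine mul_le_of_le_one_right (hc j) (pow_le_one₀ (norm_nonneg _) ?_)
    exact (norm_adjoint_apply_le hA _).trans_eq (he.1 j)

end Contraction

end ComplexGaussian

/-! ### The Dirichlet kernel -/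

/-- The Dirichlet kernel `∑_{τ < M} e^{2π i τ x}`, one-sided: it is the frequency response of the
filters given by the Fourier vectors. -/
noncomputable def dirichlet (M : ℕ) (x : ℝ) : ℂ :=
  ∑ τ ∈ Finset.range M, (𝐞 (τ * x) : ℂ)

theorem fourierChar_eq_one_iff {x : ℝ} : 𝐞 x = 1 ↔ ∃ n : ℤ, x = n := by
  rw [Real.fourierChar_apply', Circle.exp_eq_one]
  refine exists_congr fun n => ?_
  rw [mul_comm (n : ℝ), mul_right_inj' (by positivity)]

theorem fourierChar_intCast (n : ℤ) : 𝐞 (n : ℝ) = 1 :=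
  fourierChar_eq_one_iff.2 ⟨n, rfl⟩

theorem norm_dirichlet_le (M : ℕ) (x : ℝ) : ‖dirichlet M x‖ ≤ M := by
  refine (norm_sum_le _ _).trans_eq ?_
  simp only [Circle.norm_coe, Finset.sum_const, Finset.card_range, nsmul_eq_mul, mul_one]

theorem dirichlet_add_one (M : ℕ) (x : ℝ) : dirichlet M (x + 1) = dirichlet M x := by
  refine Finset.sum_congr rfl fun τ _ => ?_
  rw [mul_add, mul_one, AddChar.map_add_eq_mul, ← Int.cast_natCast τ, fourierChar_intCast,
    mul_one]

theorem dirichlet_mul_sub_one (M : ℕ) (x : ℝ) :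
    dirichlet M x * (𝐞 x - 1) = (𝐞 (M * x) : ℂ) - 1 := by
  have hpow : ∀ k : ℕ, (𝐞 (k * x) : ℂ) = (𝐞 x : ℂ) ^ k := fun k => by
    rw [← nsmul_eq_mul, AddChar.map_nsmul_eq_pow, Circle.coe_pow]
  simp only [dirichlet, hpow, geom_sum_mul]

theorem dirichlet_zero (M : ℕ) : dirichlet M 0 = M := by
  simp [dirichlet]

theorem dirichlet_div_eq_zero {N : ℕ} {a : ℤ} (ha : ¬ (N : ℤ) ∣ a) :
    dirichlet N (a / N) = 0 := by
  rcases N.eq_zero_or_pos with rfl | hN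
  · simp [dirichlet]
  have hN₀ : (N : ℝ) ≠ 0 := by exact_mod_cast hN.ne'
  have hchar : (𝐞 ((a : ℝ) / N) : ℂ) ≠ 1 := fun h => by
    obtain ⟨q, hq⟩ := fourierChar_eq_one_iff.1 (Circle.coe_eq_one.1 h)
    rw [div_eq_iff hN₀] at hq
    exact ha (Dvd.intro_left q (by exact_mod_cast hq.symm))
  have h := dirichlet_mul_sub_one N (a / N)
  rw [mul_div_cancel₀ _ hN₀, fourierChar_intCast, Circle.coe_one, sub_self, mul_eq_zero] at h
  exact h.resolve_right (sub_ne_zero.2 hchar)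

theorem norm_fourierChar_sub_one (x : ℝ) : ‖(𝐞 x : ℂ) - 1‖ = 2 * |Real.sin (Real.pi * x)| := by
  rw [Real.fourierChar_apply, mul_comm (Complex.ofReal _), Complex.norm_exp_I_mul_ofReal_sub_one,
    Real.norm_eq_abs, abs_mul, abs_two]
  ring_nf

theorem norm_dirichlet_mul_abs_sin_le (M : ℕ) (x : ℝ) :
    ‖dirichlet M x‖ * |Real.sin (Real.pi * x)| ≤ 1 := by
  have h : ‖dirichlet M x‖ * (2 * |Real.sin (Real.pi * x)|) ≤ 2 := by
    rw [← norm_fourierChar_sub_one, ← norm_mul, dirichlet_mul_sub_one]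
    refine (norm_sub_le _ _).trans_eq ?_
    rw [Circle.norm_coe, norm_one, one_add_one_eq_two]
  linarith

theorem two_mul_mul_one_sub_le_sin_pi_mul {x : ℝ} (h₀ : 0 ≤ x) (h₁ : x ≤ 1) :
    2 * x * (1 - x) ≤ Real.sin (Real.pi * x) := by
  have hhalf : ∀ y : ℝ, 0 ≤ y → y ≤ 1 / 2 → 2 * y * (1 - y) ≤ Real.sin (Real.pi * y) := by
    intro y hy₀ hy₁
    have hs := Real.mul_le_sin (x := Real.pi * y) (by positivity) (by nlinarith [Real.pi_pos])
    rw [← mul_assoc, div_mul_cancel₀ _ Real.pi_ne_zero] at hs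
    nlinarith
  rcases le_total x (1 / 2) with hx | hx
  · exact hhalf x h₀ hx
  · rw [← Real.sin_pi_sub, ← mul_one_sub, mul_right_comm]
    simpa only [sub_sub_cancel] using hhalf (1 - x) (by linarith) (by linarith)

theorem norm_dirichlet_le_of_mem_Ioo (M : ℕ) {x : ℝ} (hx : x ∈ Set.Ioo 0 1) :
    ‖dirichlet M x‖ ≤ (2 * x)⁻¹ + (2 * (1 - x))⁻¹ := by
  obtain ⟨h₀, h₁⟩ := hx
  have : 0 < 1 - x := by linarith
  have hsin := (two_mul_mul_one_sub_le_sin_pi_mul h₀.le h₁.le).trans (le_abs_self _)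
  calc ‖dirichlet M x‖ ≤ (2 * x * (1 - x))⁻¹ := by
        rw [← one_div, le_div_iff₀ (by positivity)]
        exact (mul_le_mul_of_nonneg_left hsin (norm_nonneg _)).trans
          (norm_dirichlet_mul_abs_sin_le M x)
    _ = (2 * x)⁻¹ + (2 * (1 - x))⁻¹ := by field_simp; ring

theorem sum_range_add_of_periodic {β : Type*} [AddCancelCommMonoid β] {N : ℕ} {F : ℤ → β}
    (hF : Function.Periodic F N) (p : ℤ) :
    ∑ j ∈ Finset.range N, F (p + j) = ∑ j ∈ Finset.range N, F j := by
  have hstep : ∀ p : ℤ,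
      ∑ j ∈ Finset.range N, F (p + 1 + j) = ∑ j ∈ Finset.range N, F (p + j) := by
    intro p
    have h := Finset.sum_range_succ (fun j : ℕ => F (p + j)) N
    rw [Finset.sum_range_succ', hF] at h
    simp only [Nat.cast_zero, add_zero, add_left_inj] at h
    rw [← h]
    refine Finset.sum_congr rfl fun j _ => ?_
    congr 1; push_cast; ring
  induction p using Int.induction_on with
  | zero => simp
  | succ i ih => rw [hstep, ih]
  | pred i ih => rw [← ih, ← hstep]; simp

theorem sum_range_inv_le (N : ℕ) : ∑ i ∈ Finset.range N, (i : ℝ)⁻¹ ≤ 1 + Real.log N := by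
  rcases N with _ | n
  · simp
  have hharmonic : ∑ i ∈ Finset.range (n + 1), (i : ℝ)⁻¹ = harmonic n := by
    rw [Finset.sum_range_succ', harmonic]
    push_cast
    simp
  have hlog : Real.log n ≤ Real.log (n + 1 : ℕ) := by
    rcases n.eq_zero_or_pos with rfl | hn
    · simp
    · gcongr
      exact n.le_succ
  linarith [harmonic_le_one_add_log n]

/-- At the two end points one of the inverses is `0⁻¹ = 0`, and the indicator takes over. -/
theorem norm_dirichlet_grid_le (M : ℕ) {N i : ℕ} (hi : i < N) {r : ℝ} (hr₀ : 0 ≤ r)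
    (hr₁ : r ≤ 1) :
    ‖dirichlet M ((r + i) / N)‖ ≤ (if i = 0 then (M : ℝ) else 0)
      + (if i = N - 1 then (M : ℝ) else 0)
      + N / 2 * ((i : ℝ)⁻¹ + ((N - 1 - i : ℕ) : ℝ)⁻¹) := by
  have hN : (0 : ℝ) < N := by exact_mod_cast hi.pos
  have hM := norm_dirichlet_le M ((r + i) / N)
  have hpos : 0 ≤ N / 2 * ((i : ℝ)⁻¹ + ((N - 1 - i : ℕ) : ℝ)⁻¹) := by positivity
  have hM₀ : (0 : ℝ) ≤ M := by positivity
  by_cases hends : i = 0 ∨ i = N - 1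
  · rcases hends with h | h <;> rw [if_pos h] <;> split_ifs <;> linarith only [hM, hpos, hM₀]
  obtain ⟨hi₀, hi₁⟩ := not_or.1 hends
  have hiR : (0 : ℝ) < i := by exact_mod_cast Nat.pos_of_ne_zero hi₀
  have hk : (0 : ℝ) < N - 1 - i := by
    have : i + 1 < N := by omega
    have : (i : ℝ) + 1 < N := by exact_mod_cast this
    linarith
  rw [if_neg hi₀, if_neg hi₁, zero_add, zero_add, Nat.cast_sub (by omega),
    Nat.cast_sub (by omega), Nat.cast_one]
  have hlt : (r + i) / N < 1 := by rw [div_lt_one hN]; linarith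
  calc ‖dirichlet M ((r + i) / N)‖
      ≤ (2 * ((r + i) / N))⁻¹ + (2 * (1 - (r + i) / N))⁻¹ :=
        norm_dirichlet_le_of_mem_Ioo M ⟨by positivity, hlt⟩
    _ = N / 2 * ((r + i)⁻¹ + (N - (r + i))⁻¹) := by
        have : (N : ℝ) - (r + i) ≠ 0 := by linarith
        field_simp
    _ ≤ N / 2 * ((i : ℝ)⁻¹ + ((N : ℝ) - 1 - i)⁻¹) := by
        have h₁ : (r + i)⁻¹ ≤ (i : ℝ)⁻¹ := inv_anti₀ hiR (by linarith)
        have h₂ : (N - (r + i))⁻¹ ≤ ((N : ℝ) - 1 - i)⁻¹ := inv_anti₀ hk (by linarith)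
        gcongr

theorem sum_norm_dirichlet_le {M N : ℕ} (hN : 0 < N) (x : ℝ) :
    ∑ j ∈ Finset.range N, ‖dirichlet M (x + j / N)‖ ≤ 2 * M + N * (1 + Real.log N) := by
  have hN₀ : (N : ℝ) ≠ 0 := by exact_mod_cast hN.ne'
  set r := Int.fract (N * x)
  let F : ℤ → ℝ := fun i => ‖dirichlet M ((r + i) / N)‖
  have hF : Function.Periodic F N := fun i => by
    simp only [F]
    rw [← dirichlet_add_one M ((r + i) / N)]
    congr 2; push_cast; field_simp; ring
  calc ∑ j ∈ Finset.range N, ‖dirichlet M (x + j / N)‖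
      = ∑ j ∈ Finset.range N, F (⌊N * x⌋ + j) := by
        refine Finset.sum_congr rfl fun j _ => ?_
        simp only [F]
        push_cast
        rw [← add_assoc, Int.fract_add_floor, add_div, mul_div_cancel_left₀ _ hN₀]
    _ = ∑ j ∈ Finset.range N, F j := sum_range_add_of_periodic hF _
    _ ≤ ∑ i ∈ Finset.range N, ((if i = 0 then (M : ℝ) else 0)
          + (if i = N - 1 then (M : ℝ) else 0)
          + N / 2 * ((i : ℝ)⁻¹ + ((N - 1 - i : ℕ) : ℝ)⁻¹)) :=
        Finset.sum_le_sum fun i hi => by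
          simpa only [F, Int.cast_natCast] using norm_dirichlet_grid_le M
            (Finset.mem_range.1 hi) (Int.fract_nonneg _) (Int.fract_lt_one (N * x)).le
    _ = 2 * M + N * ∑ i ∈ Finset.range N, (i : ℝ)⁻¹ := by
        rw [Finset.sum_add_distrib, Finset.sum_add_distrib, ← Finset.mul_sum,
          Finset.sum_add_distrib, Finset.sum_range_reflect (fun i : ℕ => (i : ℝ)⁻¹) N,
          Finset.sum_ite_eq', Finset.sum_ite_eq', if_pos (Finset.mem_range.2 hN),
          if_pos (Finset.mem_range.2 (Nat.sub_one_lt hN.ne'))]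
        ring
    _ ≤ 2 * M + N * (1 + Real.log N) := by
        gcongr
        exact sum_range_inv_le N

/-! ### The Fourier basis -/

/-- The `k`-th vector of the unitary Fourier basis of `ℂ^N`; the sign of the frequency makes the
inner product against it the transform `dft`. -/
noncomputable def fourierVec (N : ℕ) (k : Fin N) : EuclideanSpace ℂ (Fin N) :=
  WithLp.toLp 2 fun t => ((√(N : ℝ))⁻¹ : ℝ) * 𝐞 (-((k * t : ℝ) / N))

theorem inner_fourierVec (N : ℕ) (k l : Fin N) :
    inner ℂ (fourierVec N k) (fourierVec N l)
      = (N : ℂ)⁻¹ * dirichlet N (((k : ℝ) - l) / N) := by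
  rw [PiLp.inner_apply, dirichlet, Finset.mul_sum,
    ← Fin.sum_univ_eq_sum_range (fun t => (N : ℂ)⁻¹ * (𝐞 (t * (((k : ℝ) - l) / N)) : ℂ))]
  refine Finset.sum_congr rfl fun t _ => ?_
  have hsqrt : ((√(N : ℝ) : ℂ))⁻¹ * ((√(N : ℝ) : ℂ))⁻¹ = (N : ℂ)⁻¹ := by
    rw [← mul_inv, ← Complex.ofReal_mul, Real.mul_self_sqrt (by positivity), Complex.ofReal_natCast]
  have hchar : (𝐞 (t * (((k : ℝ) - l) / N)) : ℂ)
      = 𝐞 (-((l * t : ℝ) / N)) * 𝐞 ((k * t : ℝ) / N) := by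
    rw [← Circle.coe_mul, ← AddChar.map_add_eq_mul]
    ring_nf
  simp only [fourierVec, RCLike.inner_apply, map_mul, ← Circle.coe_inv_eq_conj, Complex.conj_ofReal,
    ← AddChar.map_neg_eq_inv, neg_neg]
  push_cast
  rw [hchar, ← hsqrt]
  ring

theorem orthonormal_fourierVec (N : ℕ) : Orthonormal ℂ (fourierVec N) := by
  rw [orthonormal_iff_ite]
  intro k l
  rw [inner_fourierVec]
  split_ifs with hkl
  · have hN : (N : ℂ) ≠ 0 := by exact_mod_cast k.pos.ne'
    rw [hkl, sub_self, zero_div, dirichlet_zero, inv_mul_cancel₀ hN]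
  · have hndvd : ¬ (N : ℤ) ∣ ((k : ℕ) : ℤ) - ((l : ℕ) : ℤ) := fun hdvd => by
      have := Int.eq_zero_of_abs_lt_dvd hdvd (by rw [abs_lt]; omega)
      exact hkl (Fin.ext (by omega))
    have hzero := dirichlet_div_eq_zero hndvd
    push_cast at hzero
    rw [hzero, mul_zero]

/-- The unitary Fourier basis of `ℂ^N`. -/
noncomputable def fourierBasis (N : ℕ) : OrthonormalBasis (Fin N) ℂ (EuclideanSpace ℂ (Fin N)) :=
  OrthonormalBasis.mk (orthonormal_fourierVec N)
    ((orthonormal_fourierVec N).linearIndependent.span_eq_top_of_card_eq_finrank' (by simp)).ge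

theorem fourierBasis_apply (N : ℕ) (k : Fin N) : fourierBasis N k = fourierVec N k := by
  simp [fourierBasis]

theorem eq_sum_inner_fourierVec_mul {N : ℕ} (v : EuclideanSpace ℂ (Fin N)) (i : Fin N) :
    v i = ∑ k, inner ℂ (fourierVec N k) v * fourierVec N k i := by
  have h := congrArg (fun w : EuclideanSpace ℂ (Fin N) => w i) ((fourierBasis N).sum_repr' v)
  simpa [fourierBasis_apply] using h.symm

theorem fourierVec_sub {N : ℕ} (k : Fin N) {i τ : ℕ} (hi : i < N) (hτ : τ ≤ i) :
    fourierVec N k ⟨i - τ, by omega⟩ = fourierVec N k ⟨i, hi⟩ * 𝐞 ((k * τ : ℝ) / N) := by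
  simp only [fourierVec]
  rw [mul_assoc, ← Circle.coe_mul, ← AddChar.map_add_eq_mul, Nat.cast_sub hτ]
  ring_nf

/-! ### Windows and filters -/

/-- The window `(x_0, …, x_n)` as a vector of the Euclidean space. -/
noncomputable def window (n : ℕ) : (ℤ → ℂ) →ₗ[ℂ] EuclideanSpace ℂ (Fin (n + 1)) where
  toFun x := WithLp.toLp 2 fun t => x (t : ℕ)
  map_add' _ _ := rfl
  map_smul' _ _ := rfl

@[simp] theorem window_apply (n : ℕ) (x : ℤ → ℂ) (t : Fin (n + 1)) :
    window n x t = x (t : ℕ) := rfl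

theorem windowNorm_eq (n : ℕ) (x : ℤ → ℂ) : windowNorm n x = ‖window n x‖ := by
  rw [windowNorm, EuclideanSpace.norm_eq, ← Fin.sum_univ_eq_sum_range (fun t => ‖x (t : ℤ)‖ ^ 2)]
  rfl

theorem iterate_shift_apply (τ : ℕ) (x : ℤ → ℂ) (t : ℤ) : shift^[τ] x t = x (t - τ) := by
  induction τ generalizing t with
  | zero => simp
  | succ τ ih =>
    rw [Function.iterate_succ_apply', shift, ih]
    congr 1; push_cast; ring

theorem dft_eq_inner (m : ℕ) (x : ℤ → ℂ) (k : Fin (m + 1)) :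
    dft m x k = inner ℂ (fourierVec (m + 1) k) (window m x) := by
  rw [dft, ← Fin.sum_univ_eq_sum_range (fun t => x (t : ℤ) *
    Complex.exp (2 * Real.pi * Complex.I * k * t / (m + 1))), PiLp.inner_apply, Finset.mul_sum]
  refine Finset.sum_congr rfl fun t _ => ?_
  have hchar : (𝐞 ((k * t : ℝ) / ((m : ℝ) + 1)) : ℂ)
      = Complex.exp (2 * Real.pi * Complex.I * k * t / (m + 1)) := by
    rw [Real.fourierChar_apply]
    congr 1
    push_cast
    ring
  simp only [fourierVec, RCLike.inner_apply, map_mul, ← Circle.coe_inv_eq_conj,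
    Complex.conj_ofReal, ← AddChar.map_neg_eq_inv, neg_neg, window_apply, hchar, Nat.cast_add,
    Nat.cast_one]
  ring

theorem fourierL1_eq (m : ℕ) (x : ℤ → ℂ) :
    fourierL1 m x = ∑ k, ‖inner ℂ (fourierVec (m + 1) k) (window m x)‖ := by
  rw [fourierL1, ← Fin.sum_univ_eq_sum_range (fun k => ‖dft m x k‖)]
  simp_rw [dft_eq_inner]

theorem norm_window_le_fourierL1 (m : ℕ) (x : ℤ → ℂ) : ‖window m x‖ ≤ fourierL1 m x := by
  have hparseval := (fourierBasis (m + 1)).sum_sq_norm_inner_right (window m x)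
  simp only [fourierBasis_apply] at hparseval
  rw [fourierL1_eq]
  refine le_of_sq_le_sq ?_ (by positivity)
  rw [← hparseval]
  exact Finset.sum_sq_le_sq_sum_of_nonneg fun _ _ => norm_nonneg _

theorem conv_eq_sum {m : ℕ} {φ : ℤ → ℂ} (hφ : φ ∈ filters m) (y : ℤ → ℂ) :
    conv φ y = ∑ τ : Fin (m + 1), φ (τ : ℕ) • shift^[(τ : ℕ)] y := by
  ext t
  have hsupp : ∀ τ ∉ (Finset.range (m + 1)).map Nat.castEmbedding, φ τ * y (t - τ) = 0 := by
    intro τ hτ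
    rw [hφ τ, zero_mul]
    rintro ⟨h₀, h₁⟩
    exact hτ (Finset.mem_map.2 ⟨τ.toNat, Finset.mem_range.2 (by omega), Int.toNat_of_nonneg h₀⟩)
  rw [conv, tsum_eq_sum hsupp, Finset.sum_map, Finset.sum_apply,
    ← Fin.sum_univ_eq_sum_range
      (fun τ => φ (Nat.castEmbedding τ) * y (t - (Nat.castEmbedding τ : ℤ)))]
  simp only [Nat.castEmbedding_apply, Pi.smul_apply, iterate_shift_apply, smul_eq_mul]

theorem window_conv {m : ℕ} (n : ℕ) {φ : ℤ → ℂ} (hφ : φ ∈ filters m) (y : ℤ → ℂ) :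
    window n (conv φ y) = ∑ τ : Fin (m + 1), window m φ τ • window n (shift^[(τ : ℕ)] y) := by
  simp only [conv_eq_sum hφ, map_sum, map_smul, window_apply]

/-- The window of the output, on the input `u`, of the filter given by the `k`-th Fourier
vector. -/
noncomputable def fourierOutput (m n : ℕ) (k : Fin (m + 1)) (u : ℤ → ℂ) :
    EuclideanSpace ℂ (Fin (n + 1)) :=
  ∑ τ : Fin (m + 1), fourierVec (m + 1) k τ • window n (shift^[(τ : ℕ)] u)

theorem window_conv_eq_sum_fourierOutput {m : ℕ} (n : ℕ) {φ : ℤ → ℂ} (hφ : φ ∈ filters m)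
    (y : ℤ → ℂ) :
    window n (conv φ y) = ∑ k, inner ℂ (fourierVec (m + 1) k) (window m φ) •
      fourierOutput m n k y := by
  rw [window_conv n hφ]
  simp_rw [fourierOutput, Finset.smul_sum, smul_smul]
  rw [Finset.sum_comm]
  refine Finset.sum_congr rfl fun τ _ => ?_
  rw [← Finset.sum_smul, ← eq_sum_inner_fourierVec_mul]

/-! ### The response of the Fourier filters to the noise -/

/-- The restriction of a vector to the coordinates in the range of an embedding. -/
noncomputable def restrictCoords {ι κ : Type*} [Fintype ι] [Fintype κ] (e : ι ↪ κ) :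
    EuclideanSpace ℂ κ →L[ℂ] EuclideanSpace ℂ ι :=
  LinearMap.toContinuousLinearMap
    { toFun := fun v => WithLp.toLp 2 fun i => v (e i)
      map_add' := fun _ _ => rfl
      map_smul' := fun _ _ => rfl }

@[simp] theorem restrictCoords_apply {ι κ : Type*} [Fintype ι] [Fintype κ] (e : ι ↪ κ)
    (v : EuclideanSpace ℂ κ) (i : ι) : restrictCoords e v i = v (e i) := rfl

theorem norm_restrictCoords_le {ι κ : Type*} [Fintype ι] [Fintype κ] (e : ι ↪ κ) :
    ‖restrictCoords e‖ ≤ 1 := by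
  refine ContinuousLinearMap.opNorm_le_bound _ zero_le_one fun v => ?_
  rw [one_mul, EuclideanSpace.norm_eq, EuclideanSpace.norm_eq]
  refine Real.sqrt_le_sqrt ?_
  calc ∑ i, ‖restrictCoords e v i‖ ^ 2 = ∑ i ∈ Finset.univ.map e, ‖v i‖ ^ 2 := by
        simp only [Finset.sum_map, restrictCoords_apply]
    _ ≤ ∑ i, ‖v i‖ ^ 2 := Finset.sum_le_sum_of_subset_of_nonneg (Finset.subset_univ _)
        fun _ _ _ => by positivity

/-- The vector `(z_{-m}, …, z_n)`: all the noise that a filter of bandwidth `m` sees on the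
window `0, …, n`. -/
noncomputable def noiseVec (m n : ℕ) (z : ℤ → ℂ) : EuclideanSpace ℂ (Fin (m + n + 1)) :=
  WithLp.toLp 2 fun i => z ((i : ℕ) - m)

/-- The last `n + 1` coordinates of a vector of length `m + n + 1`. -/
noncomputable def lastCoords (m n : ℕ) :
    EuclideanSpace ℂ (Fin (m + n + 1)) →L[ℂ] EuclideanSpace ℂ (Fin (n + 1)) :=
  restrictCoords (Fin.natAddEmb m)

theorem norm_lastCoords_le (m n : ℕ) : ‖lastCoords m n‖ ≤ 1 :=
  norm_restrictCoords_le _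

theorem lastCoords_apply (m n : ℕ) (v : EuclideanSpace ℂ (Fin (m + n + 1))) (t : Fin (n + 1)) :
    lastCoords m n v t = v ⟨m + t, by omega⟩ := rfl

theorem lastCoords_noiseVec (m n : ℕ) (z : ℤ → ℂ) :
    lastCoords m n (noiseVec m n z) = window n z := by
  ext t
  simp [noiseVec, lastCoords_apply]

/-- The transfer coefficients: the response of the `k`-th Fourier filter of length `m + 1` at the
`j`-th Fourier frequency of a window of length `N`. -/
noncomputable def transfer (m N : ℕ) (k : Fin (m + 1)) (j : Fin N) : ℂ :=
  ∑ τ : Fin (m + 1), fourierVec (m + 1) k τ * 𝐞 ((j * τ : ℝ) / N)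

theorem transfer_eq (m N : ℕ) (k : Fin (m + 1)) (j : Fin N) :
    transfer m N k j = ((√((m : ℝ) + 1))⁻¹ : ℝ)
      * dirichlet (m + 1) (-(k / ((m : ℝ) + 1)) + (j : ℕ) / N) := by
  rw [transfer, dirichlet, Finset.mul_sum, ← Fin.sum_univ_eq_sum_range
    (fun τ => (((√((m : ℝ) + 1))⁻¹ : ℝ) : ℂ) *
      (𝐞 (τ * (-(k / ((m : ℝ) + 1)) + (j : ℕ) / N)) : ℂ))]
  refine Finset.sum_congr rfl fun τ _ => ?_
  simp only [fourierVec, Nat.cast_add, Nat.cast_one]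
  rw [mul_assoc, ← Circle.coe_mul, ← AddChar.map_add_eq_mul]
  ring_nf

theorem norm_transfer (m N : ℕ) (k : Fin (m + 1)) (j : Fin N) :
    ‖transfer m N k j‖
      = (√((m : ℝ) + 1))⁻¹ * ‖dirichlet (m + 1) (-(k / ((m : ℝ) + 1)) + (j : ℕ) / N)‖ := by
  rw [transfer_eq, norm_mul, Complex.norm_real, Real.norm_of_nonneg (by positivity)]

theorem norm_transfer_le (m N : ℕ) (k : Fin (m + 1)) (j : Fin N) :
    ‖transfer m N k j‖ ≤ √((m : ℝ) + 1) := by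
  rw [norm_transfer, inv_mul_le_iff₀ (by positivity), Real.mul_self_sqrt (by positivity)]
  exact_mod_cast norm_dirichlet_le (m + 1) _

theorem sum_norm_transfer_le (m : ℕ) {N : ℕ} (hN : 0 < N) (k : Fin (m + 1)) :
    ∑ j : Fin N, ‖transfer m N k j‖
      ≤ √((m : ℝ) + 1) * (2 + N / ((m : ℝ) + 1) * (1 + Real.log N)) := by
  simp_rw [norm_transfer]
  rw [← Finset.mul_sum, Fin.sum_univ_eq_sum_range
    (fun j => ‖dirichlet (m + 1) (-(k / ((m : ℝ) + 1)) + j / N)‖), inv_mul_le_iff₀ (by positivity),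
    ← mul_assoc, Real.mul_self_sqrt (by positivity)]
  refine (sum_norm_dirichlet_le hN _).trans_eq ?_
  push_cast
  field_simp

theorem fourierOutput_eq_lastCoords (m n : ℕ) (k : Fin (m + 1)) (z : ℤ → ℂ) :
    fourierOutput m n k z = lastCoords m n (∑ j, (transfer m (m + n + 1) k j *
      inner ℂ (fourierVec (m + n + 1) j) (noiseVec m n z)) • fourierVec (m + n + 1) j) := by
  ext t
  have hshift : ∀ τ : Fin (m + 1), z ((t : ℕ) - (τ : ℕ))
      = ∑ j, inner ℂ (fourierVec (m + n + 1) j) (noiseVec m n z) *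
        (fourierVec (m + n + 1) j ⟨m + t, by omega⟩ * 𝐞 ((j * τ : ℝ) / (m + n + 1 : ℕ))) := by
    intro τ
    have hz : z ((t : ℕ) - (τ : ℕ)) = noiseVec m n z ⟨m + t - τ, by omega⟩ := by
      change z _ = z _
      congr 1
      push_cast [show (τ : ℕ) ≤ m + t by omega]
      ring
    rw [hz, eq_sum_inner_fourierVec_mul]
    exact Finset.sum_congr rfl fun j _ => by rw [fourierVec_sub j (by omega) (by omega)]
  simp only [fourierOutput, WithLp.ofLp_sum, WithLp.ofLp_smul, Finset.sum_apply, Pi.smul_apply,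
    smul_eq_mul, window_apply, lastCoords_apply, iterate_shift_apply, hshift, transfer,
    Finset.sum_mul, Finset.mul_sum]
  rw [Finset.sum_comm]
  refine Finset.sum_congr rfl fun j _ => Finset.sum_congr rfl fun τ _ => ?_
  ring

/-! ### The deterministic oracle inequality -/

theorem conv_add_right {m : ℕ} {φ : ℤ → ℂ} (hφ : φ ∈ filters m) (u v : ℤ → ℂ) :
    conv φ (u + v) = conv φ u + conv φ v := by
  ext t
  simp only [conv_eq_sum hφ, Finset.sum_apply, Pi.add_apply, Pi.smul_apply, iterate_shift_apply,
    smul_add, Finset.sum_add_distrib]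

theorem conv_smul_right {m : ℕ} {φ : ℤ → ℂ} (hφ : φ ∈ filters m) (c : ℂ) (u : ℤ → ℂ) :
    conv φ (c • u) = c • conv φ u := by
  ext t
  simp only [conv_eq_sum hφ, Finset.sum_apply, Pi.smul_apply, iterate_shift_apply,
    Finset.smul_sum, smul_comm c]

theorem conv_mem_of_shift_mem {m : ℕ} {φ : ℤ → ℂ} (hφ : φ ∈ filters m)
    {S : Submodule ℂ (ℤ → ℂ)} (hS : ∀ u ∈ S, shift u ∈ S) {u : ℤ → ℂ} (hu : u ∈ S) :
    conv φ u ∈ S := by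
  have hiter (τ : ℕ) : shift^[τ] u ∈ S := Set.MapsTo.iterate (s := (S : Set (ℤ → ℂ))) hS τ hu
  rw [conv_eq_sum hφ]
  exact S.sum_mem fun τ _ => S.smul_mem _ (hiter τ)

theorem fourierL1_nonneg (m : ℕ) (φ : ℤ → ℂ) : 0 ≤ fourierL1 m φ :=
  Finset.sum_nonneg fun _ _ => norm_nonneg _

theorem norm_inner_window_conv_le_of_sum_sq {m n : ℕ} {φ : ℤ → ℂ} (hφ : φ ∈ filters m)
    {u : ℤ → ℂ} {v : EuclideanSpace ℂ (Fin (n + 1))} {b : ℝ} (hb : 0 ≤ b)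
    (hu : ∑ τ : Fin (m + 1), ‖inner ℂ (window n (shift^[(τ : ℕ)] u)) v‖ ^ 2
      ≤ ((m : ℝ) + 1) * b ^ 2) :
    ‖inner ℂ v (window n (conv φ u))‖ ≤ √((m : ℝ) + 1) * fourierL1 m φ * b := by
  rw [window_conv n hφ, inner_sum]
  calc ‖∑ τ : Fin (m + 1), inner ℂ v (window m φ τ • window n (shift^[(τ : ℕ)] u))‖
      ≤ ∑ τ : Fin (m + 1), ‖window m φ τ‖ * ‖inner ℂ (window n (shift^[(τ : ℕ)] u)) v‖ := by
        refine norm_sum_le_of_le _ fun τ _ => ?_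
        rw [inner_smul_right, norm_mul, norm_inner_symm]
    _ ≤ ‖window m φ‖ * √(∑ τ : Fin (m + 1), ‖inner ℂ (window n (shift^[(τ : ℕ)] u)) v‖ ^ 2) := by
        rw [EuclideanSpace.norm_eq]
        exact Real.sum_mul_le_sqrt_mul_sqrt _ _ _
    _ ≤ fourierL1 m φ * √(((m : ℝ) + 1) * b ^ 2) :=
        mul_le_mul (norm_window_le_fourierL1 m φ) (Real.sqrt_le_sqrt hu) (Real.sqrt_nonneg _)
          (fourierL1_nonneg m φ)
    _ = √((m : ℝ) + 1) * fourierL1 m φ * b := by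
        rw [Real.sqrt_mul (by positivity), Real.sqrt_sq hb]
        ring

theorem norm_inner_window_conv_le_of_fourierOutput {m n : ℕ} {φ : ℤ → ℂ} (hφ : φ ∈ filters m)
    {u : ℤ → ℂ} {v : EuclideanSpace ℂ (Fin (n + 1))} {b : ℝ}
    (hu : ∀ k, ‖inner ℂ v (fourierOutput m n k u)‖ ≤ √((m : ℝ) + 1) * b) :
    ‖inner ℂ v (window n (conv φ u))‖ ≤ √((m : ℝ) + 1) * fourierL1 m φ * b := by
  rw [window_conv_eq_sum_fourierOutput n hφ, inner_sum, mul_right_comm, mul_comm, fourierL1_eq,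
    Finset.sum_mul]
  refine norm_sum_le_of_le _ fun k _ => ?_
  rw [inner_smul_right, norm_mul]
  exact mul_le_mul_of_nonneg_left (hu k) (norm_nonneg _)

theorem inner_window_conv_eq_zero {m n : ℕ} {φ : ℤ → ℂ} (hφ : φ ∈ filters m)
    {S : Submodule ℂ (ℤ → ℂ)} (hS : ∀ u ∈ S, shift u ∈ S) {u : ℤ → ℂ} (hu : u ∈ S)
    {v : EuclideanSpace ℂ (Fin (n + 1))} (hv : v ∈ (S.map (window n))ᗮ) :
    inner ℂ v (window n (conv φ u)) = 0 :=
  (Submodule.mem_orthogonal' _ _).1 hv _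
    (Submodule.mem_map_of_mem (conv_mem_of_shift_mem hφ hS hu))

-- A shortcut: the general instance search for this fact is very slow.
instance hasOrthogonalProjection_euclideanSpace {ι : Type*} [Fintype ι]
    (K : Submodule ℂ (EuclideanSpace ℂ ι)) : K.HasOrthogonalProjection :=
  .ofCompleteSpace K

/-- The noise realizations to which the deterministic oracle inequality applies: `K` is the space
of windows of the shift-invariant subspace, and the part of the noise orthogonal to `K` is weakly
correlated with the shifts of the residual `ε` and with the responses of the Fourier filters to
the noise itself. -/
structure IsTypicalNoise (m n : ℕ) (K : Submodule ℂ (EuclideanSpace ℂ (Fin (n + 1))))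
    (ε : ℤ → ℂ) (p bε bz : ℝ) (z : ℤ → ℂ) : Prop where
  norm_starProjection_le : ‖K.starProjection (window n z)‖ ≤ p
  sum_norm_inner_shift_sq_le : ∑ τ : Fin (m + 1),
    ‖inner ℂ (window n (shift^[(τ : ℕ)] ε)) (Kᗮ.starProjection (window n z))‖ ^ 2
      ≤ ((m : ℝ) + 1) * bε ^ 2
  norm_inner_fourierOutput_le : ∀ k,
    ‖inner ℂ (Kᗮ.starProjection (window n z)) (fourierOutput m n k z)‖ ≤ √((m : ℝ) + 1) * bz

section Deterministic

variable {m n : ℕ} {S : Submodule ℂ (ℤ → ℂ)} {xS ε z : ℤ → ℂ} {σ lam p bε bz : ℝ}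

theorem IsTypicalNoise.norm_inner_window_conv_le
    (hz : IsTypicalNoise m n (S.map (window n)) ε p (σ * bε) bz z)
    (hσ : 0 ≤ σ) (hbε : 0 ≤ bε) (hS : ∀ u ∈ S, shift u ∈ S) (hxS : xS ∈ S)
    {φ : ℤ → ℂ} (hφ : φ ∈ filters m) :
    ‖inner ℂ ((S.map (window n))ᗮ.starProjection (window n z))
        (window n (conv φ (xS + ε + (σ : ℂ) • z)))‖
      ≤ σ * (√((m : ℝ) + 1) * fourierL1 m φ) * (bε + bz) := by
  rw [conv_add_right hφ, conv_add_right hφ, conv_smul_right hφ, map_add, map_add, map_smul,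
    inner_add_right, inner_add_right, inner_smul_right,
    inner_window_conv_eq_zero hφ hS hxS (Submodule.starProjection_apply_mem _ _), zero_add]
  refine (norm_add_le _ _).trans ?_
  rw [norm_mul, Complex.norm_real, Real.norm_of_nonneg hσ]
  have hε := norm_inner_window_conv_le_of_sum_sq hφ (mul_nonneg hσ hbε)
    hz.sum_norm_inner_shift_sq_le
  have hnoise := norm_inner_window_conv_le_of_fourierOutput hφ hz.norm_inner_fourierOutput_le
  linarith [mul_le_mul_of_nonneg_left hnoise hσ]

theorem IsTypicalNoise.re_inner_sub_le
    (hz : IsTypicalNoise m n (S.map (window n)) ε p (σ * bε) bz z)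
    (hσ : 0 ≤ σ) (hbε : 0 ≤ bε) (hS : ∀ u ∈ S, shift u ∈ S) (hxS : xS ∈ S)
    {x y φ ψ : ℤ → ℂ} (hy : y = xS + ε + (σ : ℂ) • z) (hφ : φ ∈ filters m) (hψ : ψ ∈ filters m) :
    (inner ℂ (window n (x - conv φ y) - window n (x - conv ψ y)) (window n z)).re
      ≤ p * (windowNorm n (x - conv φ y) + windowNorm n (x - conv ψ y))
        + σ * (√((m : ℝ) + 1) * fourierL1 m ψ + √((m : ℝ) + 1) * fourierL1 m φ) * (bε + bz) := by
  subst hy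
  set K := S.map (window n)
  set y := xS + ε + (σ : ℂ) • z
  have hsplit : window n z
      = K.starProjection (window n z) + Kᗮ.starProjection (window n z) :=
    (K.starProjection_add_starProjection_orthogonal _).symm
  have hpar : (inner ℂ (window n (x - conv φ y) - window n (x - conv ψ y))
      (K.starProjection (window n z))).re
      ≤ p * (windowNorm n (x - conv φ y) + windowNorm n (x - conv ψ y)) := by
    rw [mul_comm, windowNorm_eq, windowNorm_eq]
    exact ((Complex.re_le_norm _).trans (norm_inner_le_norm _ _)).trans
      (mul_le_mul (norm_sub_le _ _) hz.norm_starProjection_le (norm_nonneg _) (by positivity))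
  have horth : (inner ℂ (window n (x - conv φ y) - window n (x - conv ψ y))
      (Kᗮ.starProjection (window n z))).re
      ≤ σ * (√((m : ℝ) + 1) * fourierL1 m ψ + √((m : ℝ) + 1) * fourierL1 m φ) * (bε + bz) := by
    have hdiff : window n (x - conv φ y) - window n (x - conv ψ y)
        = window n (conv ψ y) - window n (conv φ y) := by
      rw [map_sub, map_sub, sub_sub_sub_cancel_left]
    refine (Complex.re_le_norm _).trans ?_
    rw [norm_inner_symm, hdiff, inner_sub_right, mul_add σ, add_mul]
    exact (norm_sub_le _ _).trans (add_le_add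
      (hz.norm_inner_window_conv_le hσ hbε hS hxS hψ)
      (hz.norm_inner_window_conv_le hσ hbε hS hxS hφ))
  rw [hsplit, inner_add_right, Complex.add_re]
  exact add_le_add hpar horth

theorem windowNorm_add_smul_sq (n : ℕ) (u z : ℤ → ℂ) (σ : ℝ) :
    windowNorm n (u + (σ : ℂ) • z) ^ 2 = windowNorm n u ^ 2
      + 2 * σ * (inner ℂ (window n u) (window n z)).re + σ ^ 2 * windowNorm n z ^ 2 := by
  rw [windowNorm_eq, windowNorm_eq, windowNorm_eq, map_add, map_smul, norm_add_sq (𝕜 := ℂ),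
    inner_smul_right, norm_smul, Complex.norm_real, mul_pow, Real.norm_eq_abs, sq_abs,
    RCLike.re_eq_complex_re, Complex.re_ofReal_mul]
  ring

theorem IsPenalizedSolution.windowNorm_sub_conv_sq_le {x y φ φhat : ℤ → ℂ}
    (hφhat : IsPenalizedSolution m n lam σ y φhat) (hy : y = x + (σ : ℂ) • z)
    (hφ : φ ∈ filters m) :
    windowNorm n (x - conv φhat y) ^ 2 ≤ windowNorm n (x - conv φ y) ^ 2
      + 2 * σ * (inner ℂ (window n (x - conv φ y) - window n (x - conv φhat y))
        (window n z)).re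
      + lam ^ 2 * σ ^ 2 * ((√((m : ℝ) + 1) * fourierL1 m φ) ^ 2
        - (√((m : ℝ) + 1) * fourierL1 m φhat) ^ 2) := by
  have hres (ψ : ℤ → ℂ) : y - conv ψ y = (x - conv ψ y) + (σ : ℂ) • z := by
    nth_rewrite 1 [hy]
    abel
  have hopt := hφhat.2 φ hφ
  rw [penalizedObjective, penalizedObjective, hres φ, hres φhat, windowNorm_add_smul_sq,
    windowNorm_add_smul_sq] at hopt
  rw [inner_sub_left, Complex.sub_re]
  linarith

theorem le_add_of_sq_le_penalized {X a r r' b : ℝ} (ha : 0 ≤ a) (hσ : 0 ≤ σ)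
    (hp : 0 ≤ p) (hlam : 0 < lam) (hr : 0 ≤ r) (hb : 0 ≤ b)
    (h : X ^ 2 ≤ a ^ 2 + 2 * σ * (p * (a + X) + σ * (r' + r) * b)
      + lam ^ 2 * σ ^ 2 * (r ^ 2 - r' ^ 2)) :
    X ≤ a + 2 * σ * p + σ * (lam * r + lam⁻¹ * b) := by
  -- completing the square in `r'` absorbs the terms linear in the radii into the penalty
  have hsquare : 2 * σ ^ 2 * (r' + r) * b + lam ^ 2 * σ ^ 2 * (r ^ 2 - r' ^ 2)
      = (σ * (lam * r + lam⁻¹ * b)) ^ 2 - (σ * (lam * r' - lam⁻¹ * b)) ^ 2 := by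
    field_simp
    ring
  have hR : 0 ≤ σ * (lam * r + lam⁻¹ * b) := by positivity
  have hA : 0 ≤ a + σ * p := by positivity
  have hshifted : (X - σ * p) ^ 2 ≤ (a + σ * p + σ * (lam * r + lam⁻¹ * b)) ^ 2 := by
    nlinarith [sq_nonneg (σ * (lam * r' - lam⁻¹ * b)), mul_nonneg hA hR]
  linarith [le_of_abs_le (abs_le_of_sq_le_sq hshifted (by positivity))]

theorem IsPenalizedSolution.windowNorm_sub_conv_le {y φ φhat : ℤ → ℂ}
    (hφhat : IsPenalizedSolution m n lam σ y φhat)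
    (hz : IsTypicalNoise m n (S.map (window n)) ε p (σ * bε) bz z)
    (hσ : 0 ≤ σ) (hlam : 0 < lam) (hbε : 0 ≤ bε) (hbz : 0 ≤ bz)
    (hS : ∀ u ∈ S, shift u ∈ S) (hxS : xS ∈ S) (hy : y = xS + ε + (σ : ℂ) • z)
    (hφ : φ ∈ filters m) :
    windowNorm n (xS + ε - conv φhat y) ≤ windowNorm n (xS + ε - conv φ y) + 2 * σ * p
      + σ * (lam * (√((m : ℝ) + 1) * fourierL1 m φ) + lam⁻¹ * (bε + bz)) := by
  have hbasic := hφhat.windowNorm_sub_conv_sq_le hy hφ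
  have hcorr := hz.re_inner_sub_le (x := xS + ε) hσ hbε hS hxS hy hφ hφhat.1
  refine le_add_of_sq_le_penalized (r' := √((m : ℝ) + 1) * fourierL1 m φhat)
    (Real.sqrt_nonneg _) hσ ((norm_nonneg _).trans hz.norm_starProjection_le) hlam
    (mul_nonneg (Real.sqrt_nonneg _) (fourierL1_nonneg m φ)) (add_nonneg hbε hbz)
    (hbasic.trans ?_)
  gcongr

end Deterministic

/-! ### The constants `c_α` and `V_α` -/

theorem cAlpha_nonneg (α : ℝ) : 0 ≤ cAlpha α := Real.sqrt_nonneg _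

theorem cAlpha_sq {α : ℝ} (hα : 0 < α) (hα1 : α ≤ 1) :
    cAlpha α ^ 2 = 2 * Real.log (16 / α) := by
  refine Real.sq_sqrt (mul_nonneg zero_le_two (Real.log_nonneg ?_))
  rw [le_div_iff₀ hα]
  linarith

theorem exp_neg_cAlpha_sq_div_two {α : ℝ} (hα : 0 < α) (hα1 : α ≤ 1) :
    Real.exp (-(cAlpha α ^ 2 / 2)) = α / 16 := by
  rw [cAlpha_sq hα hα1, mul_div_cancel_left₀ _ two_ne_zero, Real.exp_neg,
    Real.exp_log (by positivity), inv_div]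

theorem kappa_nonneg (m n : ℕ) : 0 ≤ kappa m n := Real.sqrt_nonneg _

theorem kappa_sq (m n : ℕ) : kappa m n ^ 2 = ((n : ℝ) + 1) / ((m : ℝ) + 1) :=
  Real.sq_sqrt (by positivity)

theorem div_le_one_add_kappa_sq (m n : ℕ) :
    ((m : ℝ) + n + 1) / ((m : ℝ) + 1) ≤ 1 + kappa m n ^ 2 := by
  rw [kappa_sq, div_le_iff₀ (by positivity), add_mul, div_mul_cancel₀ _ (by positivity)]
  linarith

theorem three_le_log_fiftyfive : 3 ≤ Real.log 55 := by
  rw [Real.le_log_iff_exp_le (by norm_num)]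
  calc Real.exp 3 = Real.exp 1 ^ 3 := by rw [← Real.exp_nat_mul]; norm_num
    _ ≤ 2.7182818286 ^ 3 := by
        gcongr
        exact Real.exp_one_lt_d9.le
    _ ≤ 55 := by norm_num

theorem log_fiftyfive_mul_le_log_div {N α : ℝ} (hN : 0 < N) (hα : 0 < α) (hα1 : α ≤ 1) :
    Real.log (55 * N) ≤ Real.log (55 * N / α) :=
  Real.log_le_log (by positivity) (le_div_self (by positivity) hα hα1)

theorem three_le_log_fiftyfive_mul_div {N α : ℝ} (hN : 1 ≤ N) (hα : 0 < α) (hα1 : α ≤ 1) :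
    3 ≤ Real.log (55 * N / α) := by
  refine three_le_log_fiftyfive.trans (Real.log_le_log (by norm_num) ?_)
  rw [le_div_iff₀ hα]
  linarith

theorem vAlpha_nonneg (m n : ℕ) {α : ℝ} (hα : 0 < α) (hα1 : α ≤ 1) : 0 ≤ vAlpha m n α := by
  have hlog := three_le_log_fiftyfive_mul_div (N := (m : ℝ) + n + 1)
    (le_add_of_nonneg_left (by positivity)) hα hα1
  unfold vAlpha
  positivity

theorem two_add_div_mul_le_log (m n : ℕ) :
    2 + ((m : ℝ) + n + 1) / ((m : ℝ) + 1) * (1 + Real.log ((m : ℝ) + n + 1))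
      ≤ (1 + kappa m n ^ 2) * Real.log (55 * ((m : ℝ) + n + 1)) := by
  have hlog0 : 0 ≤ Real.log ((m : ℝ) + n + 1) :=
    Real.log_nonneg (le_add_of_nonneg_left (by positivity))
  have hlog : 3 + Real.log ((m : ℝ) + n + 1) ≤ Real.log (55 * ((m : ℝ) + n + 1)) := by
    rw [Real.log_mul (by norm_num) (by positivity)]
    linarith [three_le_log_fiftyfive]
  have hratio : ((m : ℝ) + n + 1) / ((m : ℝ) + 1) * (1 + Real.log ((m : ℝ) + n + 1))
      ≤ (1 + kappa m n ^ 2) * (1 + Real.log ((m : ℝ) + n + 1)) :=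
    mul_le_mul_of_nonneg_right (div_le_one_add_kappa_sq m n) (by linarith)
  nlinarith [sq_nonneg (kappa m n)]

theorem two_rpow_mul_exp_neg_vAlpha_le (m n : ℕ) {α : ℝ} (hα : 0 < α) (hα1 : α ≤ 1) :
    2 ^ (2 + ((m : ℝ) + n + 1) / ((m : ℝ) + 1) * (1 + Real.log ((m : ℝ) + n + 1)))
      * Real.exp (-vAlpha m n α) ≤ α / (55 * ((m : ℝ) + n + 1)) := by
  set Λ := 2 + ((m : ℝ) + n + 1) / ((m : ℝ) + 1) * (1 + Real.log ((m : ℝ) + n + 1))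
  have hΛ0 : 0 ≤ Λ := by
    have : 0 ≤ Real.log ((m : ℝ) + n + 1) :=
      Real.log_nonneg (le_add_of_nonneg_left (by positivity))
    positivity
  have hL : Real.log (55 * ((m : ℝ) + n + 1)) ≤ Real.log (55 * ((m : ℝ) + n + 1) / α) :=
    log_fiftyfive_mul_le_log_div (by positivity) hα hα1
  have hΛ : Λ ≤ (1 + kappa m n ^ 2) * Real.log (55 * ((m : ℝ) + n + 1) / α) :=
    (two_add_div_mul_le_log m n).trans (by gcongr)
  have hL0 : 0 ≤ Real.log (55 * ((m : ℝ) + n + 1) / α) := by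
    linarith [three_le_log_fiftyfive_mul_div (N := (m : ℝ) + n + 1)
      (le_add_of_nonneg_left (by positivity)) hα hα1]
  have hexponent : Λ - vAlpha m n α ≤ -Real.log (55 * ((m : ℝ) + n + 1) / α) := by
    rw [vAlpha]
    nlinarith [mul_nonneg (kappa_nonneg m n) hL0, mul_nonneg (sq_nonneg (kappa m n)) hL0]
  calc 2 ^ Λ * Real.exp (-vAlpha m n α) ≤ Real.exp Λ * Real.exp (-vAlpha m n α) := by
        rw [← Real.exp_one_rpow Λ]
        gcongr
        exact Real.exp_one_gt_two.le
    _ = Real.exp (Λ - vAlpha m n α) := by rw [← Real.exp_add, sub_eq_add_neg]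
    _ ≤ Real.exp (-Real.log (55 * ((m : ℝ) + n + 1) / α)) := Real.exp_le_exp.2 hexponent
    _ = α / (55 * ((m : ℝ) + n + 1)) := by
        rw [Real.exp_neg, Real.exp_log (by positivity), inv_div]

/-! ### Typical noise has large probability -/

theorem measurableSet_isTypicalNoise (m n : ℕ)
    (K : Submodule ℂ (EuclideanSpace ℂ (Fin (n + 1)))) (ε : ℤ → ℂ) (p bε bz : ℝ) :
    MeasurableSet {z | IsTypicalNoise m n K ε p bε bz z} := by
  have hwindow (τ : ℕ) : Measurable fun z => window n (shift^[τ] z) :=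
    (WithLp.measurable_toLp 2 _).comp <| measurable_pi_lambda _ fun t => by
      simpa only [iterate_shift_apply] using measurable_pi_apply _
  have hproj (L : Submodule ℂ (EuclideanSpace ℂ (Fin (n + 1)))) :
      Measurable fun z => L.starProjection (window n z) :=
    L.starProjection.continuous.measurable.comp (hwindow 0)
  have houtput (k : Fin (m + 1)) : Measurable fun z => fourierOutput m n k z :=
    Finset.measurable_sum _ fun τ _ => (measurable_const_smul _).comp (hwindow τ)
  have hset : {z | IsTypicalNoise m n K ε p bε bz z}
      = {z | ‖K.starProjection (window n z)‖ ≤ p}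
        ∩ {z | ∑ τ : Fin (m + 1), ‖inner ℂ (window n (shift^[(τ : ℕ)] ε))
            (Kᗮ.starProjection (window n z))‖ ^ 2 ≤ ((m : ℝ) + 1) * bε ^ 2}
        ∩ ⋂ k, {z | ‖inner ℂ (Kᗮ.starProjection (window n z)) (fourierOutput m n k z)‖
            ≤ √((m : ℝ) + 1) * bz} :=
    Set.ext fun z => ⟨fun h => ⟨⟨h.1, h.2⟩, Set.mem_iInter.2 h.3⟩,
      fun h => ⟨h.1.1, h.1.2, fun k => Set.mem_iInter.1 h.2 k⟩⟩
  rw [hset]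
  refine ((measurableSet_le (hproj K).norm measurable_const).inter (measurableSet_le
    (Finset.measurable_sum _ fun τ _ => ?_) measurable_const)).inter
    (MeasurableSet.iInter fun k => measurableSet_le ?_ measurable_const)
  · exact (measurable_const.inner (hproj Kᗮ)).norm.pow_const 2
  · exact ((hproj Kᗮ).inner (houtput k)).norm

theorem norm_inner_fourierOutput_le {m n : ℕ} (K : Submodule ℂ (EuclideanSpace ℂ (Fin (n + 1))))
    {t : ℝ} (k : Fin (m + 1)) (z : ℤ → ℂ)
    (hnoise : ∑ j, ‖transfer m (m + n + 1) k j‖ *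
      ‖inner ℂ (fourierVec (m + n + 1) j) (noiseVec m n z)‖ ^ 2 ≤ t)
    (hproj : ∑ j, ‖transfer m (m + n + 1) k j‖ *
      ‖inner ℂ (fourierVec (m + n + 1) j) (ContinuousLinearMap.adjoint (lastCoords m n)
        (K.starProjection (lastCoords m n (noiseVec m n z))))‖ ^ 2 ≤ t) :
    ‖inner ℂ (K.starProjection (window n z)) (fourierOutput m n k z)‖ ≤ t := by
  rw [fourierOutput_eq_lastCoords, ← lastCoords_noiseVec, map_sum, inner_sum]
  set Z := noiseVec m n z
  set v := K.starProjection (lastCoords m n Z)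
  set c := fun j => ‖transfer m (m + n + 1) k j‖
  set e := fourierVec (m + n + 1)
  calc ‖∑ j, inner ℂ v (lastCoords m n ((transfer m (m + n + 1) k j * inner ℂ (e j) Z) • e j))‖
      ≤ ∑ j, (c j * ‖inner ℂ (e j) Z‖ ^ 2
          + c j * ‖inner ℂ (e j) (ContinuousLinearMap.adjoint (lastCoords m n) v)‖ ^ 2) / 2 := by
        refine norm_sum_le_of_le _ fun j _ => ?_
        rw [map_smul, inner_smul_right, norm_mul, norm_mul, norm_inner_symm v,
          ContinuousLinearMap.adjoint_inner_right, mul_assoc, ← mul_add, mul_div_assoc]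
        refine mul_le_mul_of_nonneg_left ?_ (norm_nonneg _)
        linarith [two_mul_le_add_sq ‖inner ℂ (e j) Z‖ ‖inner ℂ (lastCoords m n (e j)) v‖]
    _ ≤ t := by
        rw [← Finset.sum_div, Finset.sum_add_distrib]
        linarith

theorem stdGaussian_sum_transfer_tail {m n : ℕ} {α : ℝ} (hα : 0 < α) (hα1 : α ≤ 1)
    {A : EuclideanSpace ℂ (Fin (m + n + 1)) →L[ℂ] EuclideanSpace ℂ (Fin (m + n + 1))}
    (hA : ‖A‖ ≤ 1) (k : Fin (m + 1)) :
    (stdGaussian (EuclideanSpace ℂ (Fin (m + n + 1)))).real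
        {x | √((m : ℝ) + 1) * (4 * vAlpha m n α) < ∑ j, ‖transfer m (m + n + 1) k j‖ *
          ‖inner ℂ (fourierVec (m + n + 1) j) (A x)‖ ^ 2}
      ≤ α / (55 * ((m : ℝ) + n + 1)) := by
  have hsum := sum_norm_transfer_le m (Nat.succ_pos (m + n)) k
  push_cast at hsum
  refine (stdGaussian_weighted_sum_tail hA (orthonormal_fourierVec _) (Real.sqrt_nonneg _)
    (fun _ => norm_nonneg _) (norm_transfer_le m _ k) hsum _).trans ?_
  rw [mul_div_cancel_left₀ _ (four_ne_zero)]
  exact two_rpow_mul_exp_neg_vAlpha_le m n hα hα1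

theorem norm_starProjection_comp_lastCoords_le {m n : ℕ}
    (K : Submodule ℂ (EuclideanSpace ℂ (Fin (n + 1)))) :
    ‖K.starProjection ∘L lastCoords m n‖ ≤ 1 := by
  have hK : ‖K.starProjection‖ ≤ 1 := K.starProjection_norm_le
  exact (ContinuousLinearMap.opNorm_comp_le _ _).trans
    (mul_le_one₀ hK (norm_nonneg _) (norm_lastCoords_le m n))

section Probability

variable {Ω : Type*} [MeasurableSpace Ω] {P : Measure Ω}

theorem hasLaw_noiseVec {ζ : ℤ → Ω → ℂ} (hζ : ∀ t, HasLaw (ζ t) stdComplexGaussian P)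
    (hind : iIndepFun ζ P) (m n : ℕ) :
    HasLaw (fun ω => noiseVec m n fun t => ζ t ω)
      (stdGaussian (EuclideanSpace ℂ (Fin (m + n + 1)))) P := by
  have hinj : Function.Injective fun i : Fin (m + n + 1) => ((i : ℕ) : ℤ) - m :=
    fun a b h => Fin.ext (Nat.cast_injective (sub_left_injective h))
  exact hasLaw_stdGaussian_of_iIndepFun (fun _ => hζ _) (hind.precomp hinj)

theorem measureReal_preimage_le_of_hasLaw {E : Type*} [MeasurableSpace E] {μ : Measure E}
    [IsFiniteMeasure μ] {X : Ω → E} (hX : HasLaw X μ P) (B : Set E) :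
    P.real {ω | X ω ∈ B} ≤ μ.real B := by
  refine ENNReal.toReal_mono (by finiteness) ?_
  rw [← hX.map_eq]
  exact Measure.le_map_apply hX.aemeasurable B

variable {m n : ℕ} {Z : Ω → ℤ → ℂ} {α : ℝ}

theorem measureReal_norm_starProjection_window_tail
    (hZ : HasLaw (fun ω => noiseVec m n (Z ω))
      (stdGaussian (EuclideanSpace ℂ (Fin (m + n + 1)))) P)
    {K : Submodule ℂ (EuclideanSpace ℂ (Fin (n + 1)))} {s : ℕ} (hs : 1 ≤ s)
    (hK : Module.finrank ℂ K ≤ s) (hα : 0 < α) (hα1 : α ≤ 1) :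
    P.real {ω | √(2 * s) + cAlpha α < ‖K.starProjection (window n (Z ω))‖} ≤ α / 16 := by
  simp_rw [← lastCoords_noiseVec m]
  rw [← exp_neg_cAlpha_sq_div_two hα hα1]
  exact (measureReal_preimage_le_of_hasLaw hZ _).trans
    (stdGaussian_norm_starProjection_tail (norm_lastCoords_le m n) K hs hK (cAlpha_nonneg α))

theorem measureReal_sum_norm_inner_window_sq_tail
    (hZ : HasLaw (fun ω => noiseVec m n (Z ω))
      (stdGaussian (EuclideanSpace ℂ (Fin (m + n + 1)))) P)
    (K : Submodule ℂ (EuclideanSpace ℂ (Fin (n + 1)))) {J : Type*} [Fintype J]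
    {g : J → EuclideanSpace ℂ (Fin (n + 1))} {W : ℝ} (hg : ∑ j, ‖g j‖ ^ 2 ≤ W)
    (hα : 0 < α) (hα1 : α ≤ 1) :
    P.real {ω | W * (4 * cAlpha α) ^ 2
        < ∑ j, ‖inner ℂ (g j) (K.starProjection (window n (Z ω)))‖ ^ 2} ≤ 2 * (α / 16) := by
  simp_rw [← lastCoords_noiseVec m]
  refine (measureReal_preimage_le_of_hasLaw hZ {x | W * (4 * cAlpha α) ^ 2
    < ∑ j, ‖inner ℂ (g j) (K.starProjection (lastCoords m n x))‖ ^ 2}).trans ?_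
  refine (stdGaussian_sum_inner_sq_tail (norm_starProjection_comp_lastCoords_le K) g hg _).trans ?_
  rw [← exp_neg_cAlpha_sq_div_two hα hα1]
  gcongr 2 * Real.exp ?_
  linarith [sq_nonneg (cAlpha α)]

variable [IsProbabilityMeasure P]

theorem one_sub_measureReal_compl_le (s : Set Ω) :
    1 - P.real sᶜ ≤ P.real s := by
  have h := measureReal_union_le (μ := P) s sᶜ
  rw [Set.union_compl_self, probReal_univ] at h
  linarith

theorem measureReal_norm_inner_fourierOutput_tail
    (hZ : HasLaw (fun ω => noiseVec m n (Z ω))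
      (stdGaussian (EuclideanSpace ℂ (Fin (m + n + 1)))) P)
    (K : Submodule ℂ (EuclideanSpace ℂ (Fin (n + 1)))) (hα : 0 < α) (hα1 : α ≤ 1)
    (k : Fin (m + 1)) :
    P.real {ω | √((m : ℝ) + 1) * (4 * vAlpha m n α)
        < ‖inner ℂ (K.starProjection (window n (Z ω))) (fourierOutput m n k (Z ω))‖}
      ≤ 2 * (α / (55 * ((m : ℝ) + n + 1))) := by
  set T := ContinuousLinearMap.adjoint (lastCoords m n) ∘L K.starProjection ∘L lastCoords m n
  have hT : ‖T‖ ≤ 1 := (ContinuousLinearMap.opNorm_comp_le _ _).trans <| mul_le_one₀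
    ((LinearIsometryEquiv.norm_map _ _).trans_le (norm_lastCoords_le m n)) (norm_nonneg _)
    (norm_starProjection_comp_lastCoords_le K)
  let B (A : EuclideanSpace ℂ (Fin (m + n + 1)) →L[ℂ] EuclideanSpace ℂ (Fin (m + n + 1))) :=
    {x | √((m : ℝ) + 1) * (4 * vAlpha m n α) < ∑ j, ‖transfer m (m + n + 1) k j‖ *
      ‖inner ℂ (fourierVec (m + n + 1) j) (A x)‖ ^ 2}
  have hB {A} (hA : ‖A‖ ≤ 1) :
      P.real {ω | noiseVec m n (Z ω) ∈ B A} ≤ α / (55 * ((m : ℝ) + n + 1)) :=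
    (measureReal_preimage_le_of_hasLaw hZ _).trans (stdGaussian_sum_transfer_tail hα hα1 hA k)
  calc P.real {ω | √((m : ℝ) + 1) * (4 * vAlpha m n α)
        < ‖inner ℂ (K.starProjection (window n (Z ω))) (fourierOutput m n k (Z ω))‖}
      ≤ P.real ({ω | noiseVec m n (Z ω) ∈ B (ContinuousLinearMap.id ℂ _)}
          ∪ {ω | noiseVec m n (Z ω) ∈ B T}) := measureReal_mono fun ω hω => by
        by_contra hnot
        obtain ⟨hid, hproj⟩ := not_or.1 hnot
        exact (not_le.2 hω) (norm_inner_fourierOutput_le K k (Z ω) (not_lt.1 hid) (not_lt.1 hproj))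
    _ ≤ α / (55 * ((m : ℝ) + n + 1)) + α / (55 * ((m : ℝ) + n + 1)) :=
        (measureReal_union_le _ _).trans (add_le_add (hB ContinuousLinearMap.norm_id_le) (hB hT))
    _ = 2 * (α / (55 * ((m : ℝ) + n + 1))) := (two_mul _).symm

theorem measureReal_exists_norm_inner_fourierOutput_tail
    (hZ : HasLaw (fun ω => noiseVec m n (Z ω))
      (stdGaussian (EuclideanSpace ℂ (Fin (m + n + 1)))) P)
    (K : Submodule ℂ (EuclideanSpace ℂ (Fin (n + 1)))) (hα : 0 < α) (hα1 : α ≤ 1) :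
    P.real (⋃ k, {ω | √((m : ℝ) + 1) * (4 * vAlpha m n α)
        < ‖inner ℂ (K.starProjection (window n (Z ω))) (fourierOutput m n k (Z ω))‖})
      ≤ 2 / 55 * α := by
  refine (measureReal_iUnion_fintype_le _).trans ?_
  calc _ ≤ ∑ _k : Fin (m + 1), 2 * (α / (55 * ((m : ℝ) + n + 1))) :=
        Finset.sum_le_sum fun k _ => measureReal_norm_inner_fourierOutput_tail hZ K hα hα1 k
    _ = ((m : ℝ) + 1) / ((m : ℝ) + n + 1) * (2 / 55 * α) := by
        rw [Finset.sum_const, Finset.card_univ, Fintype.card_fin, nsmul_eq_mul]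
        push_cast
        field_simp
    _ ≤ 2 / 55 * α := by
        refine mul_le_of_le_one_left (by positivity) ((div_le_one (by positivity)).2 ?_)
        linarith [(n.cast_nonneg : (0 : ℝ) ≤ n)]

theorem one_sub_le_measureReal_isTypicalNoise
    (hZ : HasLaw (fun ω => noiseVec m n (Z ω))
      (stdGaussian (EuclideanSpace ℂ (Fin (m + n + 1)))) P)
    {K : Submodule ℂ (EuclideanSpace ℂ (Fin (n + 1)))} {s : ℕ} (hs : 1 ≤ s)
    (hK : Module.finrank ℂ K ≤ s) {ε : ℤ → ℂ} {D : ℝ}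
    (hε : ∀ τ : ℕ, τ ≤ m → windowNorm n (shift^[τ] ε) ≤ D) (hα : 0 < α) (hα1 : α ≤ 1) :
    1 - α ≤ P.real {ω | IsTypicalNoise m n K ε (√(2 * s) + cAlpha α) (4 * cAlpha α * D)
      (4 * vAlpha m n α) (Z ω)} := by
  have hg : ∑ τ : Fin (m + 1), ‖window n (shift^[(τ : ℕ)] ε)‖ ^ 2 ≤ ((m : ℝ) + 1) * D ^ 2 := by
    calc _ ≤ ∑ _τ : Fin (m + 1), D ^ 2 := Finset.sum_le_sum fun τ _ => by
          rw [← windowNorm_eq]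
          exact pow_le_pow_left₀ (Real.sqrt_nonneg _) (hε τ (by omega)) 2
      _ = _ := by simp
  set G := {ω | IsTypicalNoise m n K ε (√(2 * s) + cAlpha α) (4 * cAlpha α * D)
    (4 * vAlpha m n α) (Z ω)}
  let B₁ := {ω | √(2 * s) + cAlpha α < ‖K.starProjection (window n (Z ω))‖}
  let B₂ := {ω | ((m : ℝ) + 1) * D ^ 2 * (4 * cAlpha α) ^ 2 < ∑ τ : Fin (m + 1),
    ‖inner ℂ (window n (shift^[(τ : ℕ)] ε)) (Kᗮ.starProjection (window n (Z ω)))‖ ^ 2}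
  let B₃ := ⋃ k, {ω | √((m : ℝ) + 1) * (4 * vAlpha m n α)
    < ‖inner ℂ (Kᗮ.starProjection (window n (Z ω))) (fourierOutput m n k (Z ω))‖}
  have hcompl : Gᶜ ⊆ B₁ ∪ B₂ ∪ B₃ := fun ω hω => by
    by_contra hnot
    obtain ⟨h₁₂, h₃⟩ := not_or.1 hnot
    obtain ⟨h₁, h₂⟩ := not_or.1 h₁₂
    exact hω ⟨not_lt.1 h₁, (not_lt.1 h₂).trans_eq (by ring),
      fun k => not_lt.1 fun hk => h₃ (Set.mem_iUnion.2 ⟨k, hk⟩)⟩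
  have hB : P.real Gᶜ ≤ P.real B₁ + P.real B₂ + P.real B₃ := (measureReal_mono hcompl).trans
    ((measureReal_union_le _ _).trans (by gcongr; exact measureReal_union_le _ _))
  have h₁ : P.real B₁ ≤ α / 16 := measureReal_norm_starProjection_window_tail hZ hs hK hα hα1
  have h₂ : P.real B₂ ≤ 2 * (α / 16) :=
    measureReal_sum_norm_inner_window_sq_tail hZ Kᗮ hg hα hα1
  have h₃ : P.real B₃ ≤ 2 / 55 * α :=
    measureReal_exists_norm_inner_fourierOutput_tail hZ Kᗮ hα hα1
  linarith [one_sub_measureReal_compl_le (P := P) G]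

end Probability

/-! ### Comparison with the rates `r₁` and `r₂` -/

theorem log_one_div_nonneg {α : ℝ} (hα : 0 < α) (hα1 : α ≤ 1) : 0 ≤ Real.log (1 / α) :=
  Real.log_nonneg ((one_le_div hα).2 hα1)

theorem log_sixteen_div {α : ℝ} (hα : 0 < α) :
    Real.log (16 / α) = 4 * Real.log 2 + Real.log (1 / α) := by
  rw [div_eq_mul_one_div, Real.log_mul (by norm_num) (by positivity),
    show (16 : ℝ) = 2 ^ 4 by norm_num, Real.log_pow, Nat.cast_ofNat]

theorem cAlpha_le_of_log_le {α a b : ℝ} (hα : 0 < α) (ha : 0 ≤ a)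
    (h : 2 * (4 * Real.log 2 + Real.log (1 / α)) ≤ a ^ 2 * b) : cAlpha α ≤ a * √b := by
  rw [cAlpha, log_sixteen_div hα, ← Real.sqrt_sq ha, ← Real.sqrt_mul (sq_nonneg a)]
  exact Real.sqrt_le_sqrt h

theorem cAlpha_le_four_mul_sqrt {α : ℝ} (hα : 0 < α) :
    cAlpha α ≤ 4 * √(max (Real.log (1 / α)) (Real.log 2)) := by
  refine cAlpha_le_of_log_le hα zero_le_four ?_
  linarith [le_max_left (Real.log (1 / α)) (Real.log 2),
    le_max_right (Real.log (1 / α)) (Real.log 2), Real.log_pos one_lt_two]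

theorem sq_one_add_four_mul_le (κ : ℝ) : (1 + 4 * κ) ^ 2 ≤ 25 * max 1 (κ ^ 2) := by
  nlinarith [le_max_left 1 (κ ^ 2), le_max_right 1 (κ ^ 2), sq_nonneg (κ - 1)]

theorem log_two_le_log_div {N α : ℝ} (hN : 2 ≤ N) (hα : 0 < α) (hα1 : α ≤ 1) :
    Real.log 2 ≤ Real.log (N / α) :=
  Real.log_le_log two_pos (hN.trans (le_div_self (by linarith) hα hα1))

theorem log_fiftyfive_mul_add_one_div_le {N α : ℝ} (hN : 2 ≤ N) (hα : 0 < α) (hα1 : α ≤ 1) :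
    Real.log (55 * (N + 1) / α) ≤ 8 * Real.log (N / α) := by
  have : 0 < N := by linarith
  calc Real.log (55 * (N + 1) / α) ≤ Real.log (2 ^ 7 * (N / α)) := by
        refine Real.log_le_log (by positivity) ?_
        rw [← mul_div_assoc]
        gcongr ?_ / _
        linarith
    _ = 7 * Real.log 2 + Real.log (N / α) := by
        rw [Real.log_mul (by norm_num) (by positivity), Real.log_pow, Nat.cast_ofNat]
    _ ≤ 8 * Real.log (N / α) := by linarith [log_two_le_log_div hN hα hα1]

theorem vAlpha_le {m n : ℕ} (hmn : 2 ≤ m + n) {α : ℝ} (hα : 0 < α) (hα1 : α ≤ 1) :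
    vAlpha m n α ≤ 400 * (max 1 (kappa m n ^ 2) * Real.log (((m : ℝ) + n) / α)) := by
  have hN : (2 : ℝ) ≤ (m : ℝ) + n := by exact_mod_cast hmn
  calc vAlpha m n α
      ≤ 2 * (25 * max 1 (kappa m n ^ 2)) * (8 * Real.log (((m : ℝ) + n) / α)) := by
        rw [vAlpha]
        refine mul_le_mul (mul_le_mul_of_nonneg_left (sq_one_add_four_mul_le _) zero_le_two)
          ?_ ?_ (by positivity)
        · exact log_fiftyfive_mul_add_one_div_le hN hα hα1
        · exact zero_le_three.trans
            (three_le_log_fiftyfive_mul_div (by linarith) hα hα1)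
    _ = _ := by ring

theorem cAlpha_mul_add_vAlpha_le_r1 {m n : ℕ} (hmn : 2 ≤ m + n) {ϰ α : ℝ} (hϰ : 0 ≤ ϰ)
    (hα : 0 < α) (hα1 : α ≤ 1) : cAlpha α * ϰ + vAlpha m n α ≤ 400 * r1 m n ϰ α := by
  have hc : cAlpha α * ϰ ≤ 4 * √(max (Real.log (1 / α)) (Real.log 2)) * ϰ :=
    mul_le_mul_of_nonneg_right (cAlpha_le_four_mul_sqrt hα) hϰ
  have hs : 0 ≤ ϰ * √(max (Real.log (1 / α)) (Real.log 2)) := by positivity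
  rw [r1]
  linarith [vAlpha_le hmn hα hα1]

theorem log_one_div_add_le_r2 (s : ℕ) {ϱ ϰ α : ℝ} (hϱ : 1 ≤ ϱ) (hϰ : 0 ≤ ϰ) (hα : 0 < α)
    (hα1 : α ≤ 1) : Real.log (1 / α) + s ≤ r2 ϱ s ϰ α := by
  have hs : 0 ≤ ϰ * √(max (Real.log (1 / α)) (Real.log 2)) := by positivity
  rw [r2]
  linarith [le_mul_of_one_le_left (log_one_div_nonneg hα hα1) hϱ]

theorem sqrt_two_mul_add_cAlpha_le_sqrt_r2 {s : ℕ} (hs : 1 ≤ s) {ϱ ϰ α : ℝ} (hϱ : 1 ≤ ϱ)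
    (hϰ : 0 ≤ ϰ) (hα : 0 < α) (hα1 : α ≤ 1) :
    √(2 * s) + cAlpha α ≤ 5 * √(r2 ϱ s ϰ α) := by
  have hs' : (1 : ℝ) ≤ s := by exact_mod_cast hs
  have hlog := log_one_div_nonneg hα hα1
  have hr := log_one_div_add_le_r2 s hϱ hϰ hα hα1
  have hsqrt : √(2 * s) ≤ 2 * √(r2 ϱ s ϰ α) :=
    Real.sqrt_le_iff.2 ⟨by positivity, by
      rw [mul_pow, Real.sq_sqrt (by linarith)]
      linarith⟩
  have hc : cAlpha α ≤ 3 * √(r2 ϱ s ϰ α) :=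
    cAlpha_le_of_log_le hα zero_le_three (by linarith [Real.log_two_lt_d9])
  linarith

/-! ### The oracle inequalities -/

section Oracle

variable {m n s : ℕ} {σ ϰ lam ϱ α : ℝ} {S : Submodule ℂ (ℤ → ℂ)} {xS ε z y φ φhat : ℤ → ℂ}

theorem IsPenalizedSolution.windowNorm_sub_conv_le_of_isTypicalNoise
    (hφhat : IsPenalizedSolution m n lam σ y φhat)
    (hz : IsTypicalNoise m n (S.map (window n)) ε (√(2 * s) + cAlpha α)
      (4 * cAlpha α * (ϰ * σ)) (4 * vAlpha m n α) z)
    (hσ : 0 ≤ σ) (hϰ : 0 ≤ ϰ) (hlam : 0 < lam) (hα : 0 < α) (hα1 : α ≤ 1)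
    (hS : ∀ u ∈ S, shift u ∈ S) (hxS : xS ∈ S) (hy : ∀ t, y t = (xS + ε) t + σ * z t)
    (hφ : φ ∈ filters m) (hϱ : fourierL1 m φ ≤ ϱ / √((m : ℝ) + 1)) :
    windowNorm n (xS + ε - conv φhat y) ≤ windowNorm n (xS + ε - conv φ y)
      + σ * (lam * ϱ + lam⁻¹ * (4 * (cAlpha α * ϰ + vAlpha m n α))
        + 2 * (√(2 * s) + cAlpha α)) := by
  have hc := cAlpha_nonneg α
  have hV := vAlpha_nonneg m n hα hα1
  rw [show 4 * cAlpha α * (ϰ * σ) = σ * (4 * cAlpha α * ϰ) by ring] at hz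
  have horacle := hφhat.windowNorm_sub_conv_le hz hσ hlam (by positivity) (by positivity) hS hxS
    (funext hy) hφ
  have hnorm : √((m : ℝ) + 1) * fourierL1 m φ ≤ ϱ :=
    (le_div_iff₀' (Real.sqrt_pos.2 (by positivity))).1 hϱ
  have hpenalty : σ * (lam * (√((m : ℝ) + 1) * fourierL1 m φ)) ≤ σ * (lam * ϱ) := by gcongr
  linarith

theorem oracle_remainder_le_r1_r2 (hmn : 2 ≤ m + n) (hs : 1 ≤ s) (hϰ : 0 ≤ ϰ) (hlam : 0 < lam)
    (hϱ : 1 ≤ ϱ) (hα : 0 < α) (hα1 : α ≤ 1) :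
    lam * ϱ + lam⁻¹ * (4 * (cAlpha α * ϰ + vAlpha m n α)) + 2 * (√(2 * s) + cAlpha α)
      ≤ lam * ϱ + 1600 * lam⁻¹ * r1 m n ϰ α + 10 * √(r2 ϱ s ϰ α) := by
  have hr1 := mul_le_mul_of_nonneg_left (cAlpha_mul_add_vAlpha_le_r1 hmn hϰ hα hα1)
    (inv_pos.2 hlam).le
  linarith [sqrt_two_mul_add_cAlpha_le_sqrt_r2 hs hϱ hϰ hα hα1]

theorem sqrt_mul_add_mul_inv_sqrt_mul_le {r C : ℝ} (hC : 0 ≤ C) (hϱ : 1 ≤ ϱ) :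
    √r * ϱ + C * (√r)⁻¹ * r ≤ (C + 1) * ϱ * √r := by
  have hdiv : C * (√r)⁻¹ * r = C * √r := by
    rw [mul_assoc, inv_mul_eq_div, Real.div_sqrt]
  rw [hdiv]
  linarith [le_mul_of_one_le_left (mul_nonneg hC (Real.sqrt_nonneg r)) hϱ]

end Oracle

/-- The decomposition required by `NearShiftInvariant`, but with a shift-invariant subspace of
arbitrary dimension whose restriction to the window `{0, …, n}` has dimension at most `s`. -/
def NearWindowShiftInvariant (m n s : ℕ) (ϰ σ : ℝ) (x : ℤ → ℂ) : Prop :=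
  ∃ S : Submodule ℂ (ℤ → ℂ), (∀ u ∈ S, shift u ∈ S) ∧
    Module.finrank ℂ (S.map (window n)) ≤ s ∧
    ∃ xS ∈ S, ∃ ε : ℤ → ℂ, x = xS + ε ∧
      ∀ τ : ℕ, τ ≤ m → windowNorm n (shift^[τ] ε) ≤ ϰ * σ

theorem NearShiftInvariant.nearWindowShiftInvariant {m n s : ℕ} {ϰ σ : ℝ} {x : ℤ → ℂ}
    (hx : NearShiftInvariant m n s ϰ σ x) : NearWindowShiftInvariant m n s ϰ σ x := by
  obtain ⟨hs, -, S, hS, rfl, hx⟩ := hx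
  have : Module.Finite ℂ S := Module.finite_of_finrank_pos hs
  exact ⟨S, hS, Submodule.finrank_map_le _ _, hx⟩

end SignalRecovery

open SignalRecovery in
theorem theorem2_general :
    ∃ C C' C'' : ℝ, 0 < C ∧ 0 < C' ∧ 0 < C'' ∧
      ∀ (Ω : Type*) [MeasurableSpace Ω] (P : Measure Ω) [IsProbabilityMeasure P]
        (ζ : ℤ → Ω → ℂ),
        (∀ t, HasLaw (ζ t) stdComplexGaussian P) →
        iIndepFun ζ P →
      ∀ (m n s : ℕ), 2 ≤ m + n → 1 ≤ s →
      ∀ (σ ϰ : ℝ), 0 ≤ σ → 0 ≤ ϰ →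
      ∀ x : ℤ → ℂ, NearWindowShiftInvariant m n s ϰ σ x →
      ∀ α : ℝ, 0 < α → α ≤ 1 →
      ∃ Ξ : Set (ℤ → ℂ), MeasurableSet Ξ ∧
        ENNReal.ofReal (1 - α) ≤ P {ω | (fun t => ζ t ω) ∈ Ξ} ∧
        ∀ lam ϱ : ℝ, 0 < lam → 1 ≤ ϱ →
        ∀ φ ∈ filters m, fourierL1 m φ ≤ ϱ / √((m : ℝ) + 1) →
        ∀ z ∈ Ξ, ∀ y : ℤ → ℂ, (∀ t, y t = x t + σ * z t) →
        ∀ φhat : ℤ → ℂ, IsPenalizedSolution m n lam σ y φhat →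
          (windowNorm n (x - conv φhat y) ≤ windowNorm n (x - conv φ y)
            + σ * (lam * ϱ + 4 * lam⁻¹ * (cAlpha α * ϰ + vAlpha m n α))
            + 2 * σ * (√(ϱ * wAlpha m n α) + √(cAlpha α * ϰ) + √(2 * (s : ℝ)) + cAlpha α)) ∧
          (windowNorm n (x - conv φhat y) ≤ windowNorm n (x - conv φ y)
            + σ * (lam * ϱ + C * lam⁻¹ * r1 m n ϰ α + C' * √(r2 ϱ s ϰ α))) ∧
          (lam = √(r1 m n ϰ α) →
            windowNorm n (x - conv φhat y) ≤ windowNorm n (x - conv φ y)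
              + σ * (C'' * ϱ * √(r1 m n ϰ α) + C' * √(r2 ϱ s ϰ α))) := by
  refine ⟨1600, 10, 1600 + 1, by norm_num, by norm_num, by norm_num, ?_⟩
  rintro Ω _ P _ ζ hζ hind m n s hmn hs σ ϰ hσ hϰ _ ⟨S, hS, hdim, xS, hxS, ε, rfl, hε⟩ α hα hα1
  refine ⟨_, measurableSet_isTypicalNoise m n (S.map (window n)) ε (√(2 * s) + cAlpha α)
    (4 * cAlpha α * (ϰ * σ)) (4 * vAlpha m n α), ?_, ?_⟩
  · rw [← ofReal_measureReal]
    exact ENNReal.ofReal_le_ofReal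
      (one_sub_le_measureReal_isTypicalNoise (hasLaw_noiseVec hζ hind m n) hs hdim hε hα hα1)
  intro lam ϱ hlam hϱ φ hφ hφϱ z hz y hy φhat hφhat
  have hsharp := hφhat.windowNorm_sub_conv_le_of_isTypicalNoise hz hσ hϰ hlam hα hα1 hS hxS hy
    hφ hφϱ
  have hrate := hsharp.trans (add_le_add_right (mul_le_mul_of_nonneg_left
    (oracle_remainder_le_r1_r2 hmn hs hϰ hlam hϱ hα hα1) hσ) _)
  refine ⟨hsharp.trans ?_, hrate, ?_⟩
  · have hslack : 0 ≤ σ * (√(ϱ * wAlpha m n α) + √(cAlpha α * ϰ)) := by positivity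
    linarith
  · rintro rfl
    refine hrate.trans ?_
    gcongr _ + σ * (?_ + _)
    exact sqrt_mul_add_mul_inv_sqrt_mul_le (by norm_num) hϱ

theorem theorem2 :
    ∃ C C' C'' : ℝ, 0 < C ∧ 0 < C' ∧ 0 < C'' ∧
      ∀ (Ω : Type*) [MeasurableSpace Ω] (P : Measure Ω) [IsProbabilityMeasure P]
        (ζ : ℤ → Ω → ℂ),
        (∀ t, HasLaw (ζ t) SignalRecovery.stdComplexGaussian P) →
        iIndepFun ζ P →
      ∀ (m n s : ℕ), 1 ≤ m → 1 ≤ n →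
      ∀ (σ ϰ lam ϱ : ℝ), 0 ≤ σ → 0 ≤ ϰ → 0 < lam → 1 ≤ ϱ →
      ∀ x : ℤ → ℂ, SignalRecovery.NearShiftInvariant m n s ϰ σ x →
      ∀ φ ∈ SignalRecovery.filters m,
        SignalRecovery.fourierL1 m φ ≤ ϱ / √((m : ℝ) + 1) →
      ∀ α : ℝ, 0 < α → α ≤ 1 →
      ∃ Ξ : Set (ℤ → ℂ), MeasurableSet Ξ ∧
        ENNReal.ofReal (1 - α) ≤ P {ω | (fun t => ζ t ω) ∈ Ξ} ∧
        ∀ z ∈ Ξ, ∀ y : ℤ → ℂ, (∀ t, y t = x t + σ * z t) →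
        ∀ φhat : ℤ → ℂ, SignalRecovery.IsPenalizedSolution m n lam σ y φhat →
          -- the oracle inequality with explicit constants
          (SignalRecovery.windowNorm n (x - SignalRecovery.conv φhat y) ≤
            SignalRecovery.windowNorm n (x - SignalRecovery.conv φ y)
              + σ * (lam * ϱ
                + 4 * lam⁻¹ * (SignalRecovery.cAlpha α * ϰ + SignalRecovery.vAlpha m n α))
              + 2 * σ * (√(ϱ * SignalRecovery.wAlpha m n α)
                + √(SignalRecovery.cAlpha α * ϰ) + √(2 * (s : ℝ))
                + SignalRecovery.cAlpha α)) ∧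
          -- the oracle inequality with absolute constants
          (SignalRecovery.windowNorm n (x - SignalRecovery.conv φhat y) ≤
            SignalRecovery.windowNorm n (x - SignalRecovery.conv φ y)
              + σ * (lam * ϱ + C * lam⁻¹ * SignalRecovery.r1 m n ϰ α
                + C' * √(SignalRecovery.r2 ϱ s ϰ α))) ∧
          -- the particular choice of the penalization parameter
          (lam = √(SignalRecovery.r1 m n ϰ α) →
            SignalRecovery.windowNorm n (x - SignalRecovery.conv φhat y) ≤
              SignalRecovery.windowNorm n (x - SignalRecovery.conv φ y)
                + σ * (C'' * ϱ * √(SignalRecovery.r1 m n ϰ α)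
                  + C' * √(SignalRecovery.r2 ϱ s ϰ α))) := by
  obtain ⟨C, C', C'', hC, hC', hC'', horacle⟩ := theorem2_general
  refine ⟨C, C', C'', hC, hC', hC'', ?_⟩
  intro Ω _ P _ ζ hζ hind m n s hm hn σ ϰ lam ϱ hσ hϰ hlam hϱ x hx φ hφ hφϱ α hα hα1
  obtain ⟨Ξ, hΞ, hP, hbound⟩ := horacle Ω P ζ hζ hind m n s (by omega) hx.1 σ ϰ hσ hϰ x
    hx.nearWindowShiftInvariant α hα hα1
  exact ⟨Ξ, hΞ, hP, hbound lam ϱ hlam hϱ φ hφ hφϱ⟩
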